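/- **Conventions.** An *LC instance* $\mathcal D$ has a finite set of variables, a finite domain $\mathcal D_x$ for each variable $x$, and finitely many constraints $x=\alpha(y)$ with $\alpha:\mathcal D_y\to\mathcal D_x$. A *minion* $\mathcal R$ is a functor $D\mapsto\mathcal R^{(D)}$, $\alpha\mapsto\mathcal R^{(\alpha)}$ from finite sets to sets; a minion homomorphism is a natural transformation. A *solution of $\mathcal D$ in $\mathcal R$* is a family $r_x\in\mathcal R^{(\mathcal D_x)}$ with $r_x=\mathcal R^{(\alpha)}(r_y)$ for every constraint $x=\alpha(y)$. For a function $h$ on $D$ with values in an abelian group and $\alpha:D\to E$, "summing up" means $(\alpha_*h)(b)=\sum_{a\in\alpha^{-1}(b)}h(a)$. The *weight* $\mathrm w(v)$ of $v\in\mathbb Z_2^N$ is the sum of its coordinates. * $\mathcal Z_2^{(D)}$ is the set of $f:D\to\mathbb Z_2$ with $\sum_a f(a)=1$; minor maps are given by summing up. The *second saturated power* of $\mathcal D$ has as variables the pairs $x_1x_2$ of variables, with domains $\mathcal D_{x_1}\times\mathcal D_{x_2}$, and as constraints all products $\alpha_1\times\alpha_2$ of two constraints of $\mathcal D$ (the constraints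 $x=\mathrm{id}(x)$ being added to $\mathcal D$ first) and all maps $\sigma^*:(d_1,d_2)\mapsto(d_{\sigma(1)},d_{\sigma(2)})$ for $\sigma:\{1,2\}\to\{1,2\}$. * $\mathcal V_2\text{-}\mathbb Z_2^{(D)}$ is the set of triples $(V,\mathbf i,\mathbf v)$ with $V$ a subspace of some $\mathbb Z_2^N$, $\mathbf i=(1,\dots,1)\in V$, $\mathrm w(\mathbf i)=1$, $\mathbf v:D\to V$, $\sum_a\mathbf v(a)=\mathbf i$ and $\mathbf v(a)\cdot\mathbf v(b)=0$ for $a\ne b$; $\alpha$ acts by summing up $\mathbf v$. * $\mathcal M^{(D)}$ is the set of pairs $f:D\to\mathbb Z_2$, $g:D\times D\to\mathbb Z_2$ with $\sum_a f(a)=1$, $\sum_{a,b}g(a,b)=0$ and $g(a,b)+g(b,a)=f(a)f(b)$ for $a\neq b$; minor maps are given by summing up both functions. * For a finite relational structure $\mathbb A$, $\mathrm{Pol}(\mathbb A)^{(D)}$ is the set of homomorphisms $\mathbb A^D\to\mathbb A$, with $\mathrm{Pol}(\mathbb A)^{(\alpha)}(F)(a)=F(a\circ\alpha)$. An instance $\mathcal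 I$ of $\mathrm{CSP}(\mathbb A)$ is a finite list of constraints $x_1\dots x_n\in R$ with $R$ a relation of $\mathbb A$; $\mathrm{lc}(\mathcal I)$ is the LC instance whose variables are the variables of $\mathcal I$ (domain $A$) and its constraints (domain $R$), with the coordinate projections as constraints. $\mathcal R$ *solves* $\mathrm{CSP}(\mathbb A)$ if every instance $\mathcal I$ for which $\mathrm{lc}(\mathcal I)$ has a solution in $\mathcal R$ is solvable. * $\mathbf D_4$ is the dihedral group of order 8. For $m\in\mathbb N\cup\{\infty\}$, $\mathbb D_m$ is the structure on $\mathbf D_4$ whose relations are all cosets of subgroups of $\mathbf D_4^n$, $n\le m$; $\mathbb D'$ is the structure whose relations are all subgroups and all one-element subsets of $\mathbf D_4^n$, for all $n$. * BLP+AIP accepts a CSP instance if its LC instance has both a BLP solution (probability distributions on the domains, compatible with the constraints by summing up) and an AIP solution (integer-valued functions with sum $1$, likewise compatible) such that the latter vanishes wherever the former does. Singl(BLP+AIP) starts with the full domains and repeatedly removes a value $a$ from the current domain of a variable $x$ if BLP+AIP rejects the current instance with $x=a$ added; it accepts if it ends with all domains nonempty. **Theorem.** 1. For every $N$, the bilinear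 form $Q(v,w)=\sum_{i<j}v_iw_j$ on $\mathbb Z_2^N$ satisfies $$Q(v,w)+Q(w,v)=\mathrm w(v)\,\mathrm w(w)+v\cdot w\qquad\text{for all }v,w.\tag{$*$}$$ 2. Let $\mathcal D$ be an LC instance, $Q$ a bilinear form on $\mathbb Z_2^N$ with $(*)$, $\mathbf i\in\mathbb Z_2^N$ with $\mathrm w(\mathbf i)=1$, and let $\mathbf v_x:\mathcal D_x\to\mathbb Z_2^N$ satisfy $\sum_a\mathbf v_x(a)=\mathbf i$ for all $x$, $\mathbf v_x(a)\cdot\mathbf v_x(b)=0$ for $a\ne b$, and $\mathbf v_x=\alpha_*\mathbf v_y$ for every constraint $x=\alpha(y)$. Then $$f_x(a)=\mathrm w(\mathbf v_x(a)),\quad g_x(a,a)=Q(\mathbf v_x(a),\mathbf v_x(a)-\mathbf i),\quad g_x(a,b)=Q(\mathbf v_x(a),\mathbf v_x(b))\ (a\ne b)$$ defines a solution of $\mathcal D$ in $\mathcal M$, and moreover $\sum_b g_x(a,b)=0$ for all $x$ and $a$. For any choice, for each $N$, of a form with $(*)$, the same formulas define a minion homomorphism $\mathcal V_2\text{-}\mathbb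 Z_2\to\mathcal M$, again with all sums $\sum_b g(a,b)$ equal to $0$. 3. $\mathcal M$ is isomorphic to $\mathrm{Pol}(\mathbb D')$. $\mathrm{Pol}(\mathbb D_\infty)$ is isomorphic to the subminion of $\mathcal M$ consisting of the pairs with $\sum_b g(a,b)=0$ for every $a$. For every $m$ there is a minion homomorphism $\mathcal M\to\mathrm{Pol}(\mathbb D_m)$. 4. For every $m$ there is a minion homomorphism $\mathcal V_2\text{-}\mathbb Z_2\to\mathrm{Pol}(\mathbb D_m)$; every LC instance with a solution in $\mathcal V_2\text{-}\mathbb Z_2$ has a solution in $\mathrm{Pol}(\mathbb D_m)$; and $\mathcal V_2\text{-}\mathbb Z_2$ solves $\mathrm{CSP}(\mathbb D_m)$. 5. For every $m$, the second level of the $\mathbb Z_2$ relaxation decides $\mathrm{CSP}(\mathbb D_m)$: an instance $\mathcal I$ is solvable if and only if the second saturated power of $\mathrm{lc}(\mathcal I)$ has a solution in $\mathcal Z_2$. 6. For every $m\ge4$, Singl(BLP+AIP) does not solve $\mathrm{CSP}(\mathbb D_m)$: it accepts some unsolvable instance. -/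

import Mathlib

namespace SolvingSquare

/-! ### Minions -/

/-- A minion: a functor from finite sets to sets. -/
structure Minion where
  obj : (D : Type) → [Fintype D] → Type
  map : {D E : Type} → [Fintype D] → [Fintype E] → (D → E) → obj D → obj E
  map_id : ∀ {D : Type} [Fintype D] (r : obj D), map (id : D → D) r = r
  map_comp : ∀ {D E F : Type} [Fintype D] [Fintype E] [Fintype F]
    (β : E → F) (α : D → E) (r : obj D), map (β ∘ α) r = map β (map α r)

/-- A minion homomorphism: a family of functions commuting with all minor maps. -/
structure MinionHom (R S : Minion) where
  app : (D : Type) → [Fintype D] → R.obj D → S.obj D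
  naturality : ∀ {D E : Type} [Fintype D] [Fintype E] (α : D → E) (r : R.obj D),
    app E (R.map α r) = S.map α (app D r)

/-! ### Label Cover instances -/

/-- A Label Cover instance. The `c`-th constraint reads `tgt c = fn c (src c)`. -/
structure LCInstance where
  Var : Type
  [varFintype : Fintype Var]
  dom : Var → Type
  [domFintype : ∀ x, Fintype (dom x)]
  Con : Type
  [conFintype : Fintype Con]
  tgt : Con → Var
  src : Con → Var
  fn : (c : Con) → dom (src c) → dom (tgt c)

attribute [instance] LCInstance.varFintype LCInstance.domFintype LCInstance.conFintype

namespace LCInstance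

/-- `s` is a solution of the `R`-relaxation of `D`. -/
def IsSolutionIn (D : LCInstance) (R : Minion) (s : (x : D.Var) → R.obj (D.dom x)) : Prop :=
  ∀ c : D.Con, s (D.tgt c) = R.map (D.fn c) (s (D.src c))

/-- `D` has a solution in the minion `R`. -/
def SolvableIn (D : LCInstance) (R : Minion) : Prop :=
  ∃ s : (x : D.Var) → R.obj (D.dom x), D.IsSolutionIn R s

/-- `D` with all the constraints `x = id(x)` added. -/
def addId (D : LCInstance) : LCInstance where
  Var := D.Var
  dom := D.dom
  Con := D.Con ⊕ D.Var
  tgt := Sum.elim D.tgt id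
  src := Sum.elim D.src id
  fn := fun c => match c with
    | Sum.inl c => D.fn c
    | Sum.inr _ => id

/-- The `k`-th saturated power: the variables are `k`-tuples of variables, and the constraints are
products of `k` constraints (identities included) and the maps `σ^*` for all `σ : [k] → [k]`. -/
def satPower (D : LCInstance) (k : ℕ) : LCInstance where
  Var := Fin k → D.Var
  dom := fun x => (i : Fin k) → D.dom (x i)
  Con := (Fin k → D.addId.Con) ⊕ ((Fin k → D.Var) × (Fin k → Fin k))
  conFintype :=
    letI : Fintype D.addId.Con := D.addId.conFintype
    inferInstance
  tgt := Sum.elim (fun c i => D.addId.tgt (c i)) (fun p i => p.1 (p.2 i))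
  src := Sum.elim (fun c i => D.addId.src (c i)) (fun p => p.1)
  fn := fun c => match c with
    | Sum.inl c => fun d i => D.addId.fn (c i) (d i)
    | Sum.inr p => fun d i => d (p.2 i)

end LCInstance

/-! ### Summing up along a function -/

open Classical in
/-- `(push α f)(b) = ∑_{a ∈ α⁻¹(b)} f(a)`. -/
noncomputable def push {D E M : Type} [Fintype D] [AddCommMonoid M] (α : D → E) (f : D → M) :
    E → M :=
  fun b => ∑ a with α a = b, f a

section pushLemmas

variable {D E F M : Type} [Fintype D] [AddCommMonoid M]

theorem push_id (f : D → M) : push (id : D → D) f = f := by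
  classical
  funext b
  simp [push, Finset.sum_filter]

theorem push_comp [Fintype E] (β : E → F) (α : D → E) (f : D → M) :
    push (β ∘ α) f = push β (push α f) := by
  classical
  funext b
  simp only [push, Function.comp_apply]
  rw [← Finset.sum_fiberwise_of_maps_to (s := Finset.univ.filter fun a => β (α a) = b)
    (t := Finset.univ.filter fun e => β e = b) (g := α) (by simp)]
  refine Finset.sum_congr rfl fun e he => ?_
  refine Finset.sum_congr ?_ fun _ _ => rfl
  ext a
  simp only [Finset.mem_filter, Finset.mem_univ, true_and] at he ⊢
  constructor
  · rintro ⟨_, h⟩; exact h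
  · intro h; exact ⟨by rw [h, he], h⟩

theorem sum_push [Fintype E] (α : D → E) (f : D → M) : ∑ b, push α f b = ∑ a, f a := by
  classical
  simp only [push]
  exact Finset.sum_fiberwise _ _ _

theorem push_prodMap_apply (α : D → E) (g : D × D → M) (c d : E) :
    push (Prod.map α α) g (c, d) =
      open Classical in ∑ a with α a = c, ∑ b with α b = d, g (a, b) := by
  classical
  simp only [push]
  rw [← Finset.sum_product']
  refine Finset.sum_congr ?_ fun _ _ => rfl
  ext ⟨a, b⟩
  simp [Prod.ext_iff]

end pushLemmas

/-! ### The minions `Z_n` -/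

/-- The minion `Z_n`: functions `D → ℤ/n` with sum `1`. -/
noncomputable def zMinion (n : ℕ) : Minion where
  obj := fun D _ => {f : D → ZMod n // ∑ a, f a = 1}
  map := fun α f => ⟨push α f.1, by rw [sum_push, f.2]⟩
  map_id := fun f => Subtype.ext (push_id f.1)
  map_comp := fun β α f => Subtype.ext (push_comp β α f.1)

/-! ### The vector minions `V_k-Z_p` -/

/-- The weight of a vector: the sum of its coordinates. -/
def weight {p N : ℕ} (v : Fin N → ZMod p) : ZMod p := ∑ j, v j

/-- The elements `(V, i, v)` of `V_k-Z_p^{(D)}`, for `k ≥ 2`. Multiplication of vectors is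
componentwise. -/
@[ext]
structure VectorObj (k p : ℕ) (D : Type) [Fintype D] where
  N : ℕ
  V : Submodule (ZMod p) (Fin N → ZMod p)
  i : Fin N → ZMod p
  v : D → Fin N → ZMod p
  i_mem : i ∈ V
  v_mem : ∀ a, v a ∈ V
  i_eq : i = fun _ => 1
  weight_i : weight i = 1
  sum_v : ∑ a, v a = i
  orth : ∀ a b, a ≠ b → ∀ u : Fin (k - 2) → Fin N → ZMod p, (∀ j, u j ∈ V) →
    weight (v a * v b * ∏ j, u j) = 0
  idem : ∀ a, ∀ u : Fin (k - 2) → Fin N → ZMod p, (∀ j, u j ∈ V) →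
    weight (v a * v a * ∏ j, u j) = weight (v a * ∏ j, u j)

theorem weight_sum {p N : ℕ} {ι : Type} (s : Finset ι) (f : ι → Fin N → ZMod p) :
    weight (∑ a ∈ s, f a) = ∑ a ∈ s, weight (f a) := by
  simp only [weight, Finset.sum_apply]
  exact Finset.sum_comm

/-- The minor map of `V_k-Z_p`: `(V, i, v) ↦ (V, i, push α v)`. -/
noncomputable def VectorObj.map {k p : ℕ} {D E : Type} [Fintype D] [Fintype E] (α : D → E)
    (t : VectorObj k p D) : VectorObj k p E where
  N := t.N
  V := t.V
  i := t.i
  v := push α t.v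
  i_mem := t.i_mem
  v_mem := fun b => by
    classical
    exact Submodule.sum_mem _ fun a _ => t.v_mem a
  i_eq := t.i_eq
  weight_i := t.weight_i
  sum_v := by rw [sum_push, t.sum_v]
  orth := fun c d hcd u hu => by
    classical
    simp only [push]
    rw [Finset.sum_mul_sum, Finset.sum_mul, weight_sum]
    simp only [Finset.sum_mul, weight_sum]
    refine Finset.sum_eq_zero fun a ha => Finset.sum_eq_zero fun b hb => ?_
    refine t.orth a b ?_ u hu
    rintro rfl
    simp only [Finset.mem_filter, Finset.mem_univ, true_and] at ha hb
    exact hcd (ha.symm.trans hb)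
  idem := fun c u hu => by
    classical
    simp only [push]
    rw [Finset.sum_mul_sum, Finset.sum_mul, Finset.sum_mul, weight_sum, weight_sum]
    simp only [Finset.sum_mul, weight_sum]
    refine Finset.sum_congr rfl fun a ha => ?_
    rw [Finset.sum_eq_single a (fun b _ hb => t.orth a b hb.symm u hu) (fun h => absurd ha h)]
    exact t.idem a u hu

/-- The vector minion `V_k-Z_p`. -/
noncomputable def vectorMinion (k p : ℕ) : Minion where
  obj := fun D _ => VectorObj k p D
  map := fun α t => t.map α
  map_id := fun t => VectorObj.ext rfl HEq.rfl HEq.rfl (heq_of_eq (push_id t.v))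
  map_comp := fun β α t => VectorObj.ext rfl HEq.rfl HEq.rfl (heq_of_eq (push_comp β α t.v))

/-- A family of vectors `v_x(a) ∈ Z_2^N` attached to the points of `D` which is a solution of the
vector relaxation with common sum `i`. -/
structure IsVectorSolution (D : LCInstance) {N : ℕ} (i : Fin N → ZMod 2)
    (v : (x : D.Var) → D.dom x → Fin N → ZMod 2) : Prop where
  weight_i : weight i = 1
  sum_v : ∀ x, ∑ a, v x a = i
  orth : ∀ x a b, a ≠ b → v x a ⬝ᵥ v x b = 0
  constr : ∀ c, v (D.tgt c) = push (D.fn c) (v (D.src c))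

/-- The identity `Q(v,w) + Q(w,v) = w(v) w(w) + v · w` for a bilinear form on `Z_2^N`. -/
def IsRoundingForm {N : ℕ} (Q : LinearMap.BilinForm (ZMod 2) (Fin N → ZMod 2)) : Prop :=
  ∀ v w, Q v w + Q w v = weight v * weight w + v ⬝ᵥ w

/-! ### The minion `M` of pairs `(f, g)` -/

/-- The elements `(f, g)` of `M^{(D)}`. -/
@[ext]
structure SquareObj (D : Type) [Fintype D] where
  f : D → ZMod 2
  g : D × D → ZMod 2
  sum_f : ∑ a, f a = 1
  sum_g : ∑ q, g q = 0
  symm : ∀ a b, a ≠ b → g (a, b) + g (b, a) = f a * f b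

/-- The minion `M`; minor maps are given by summing up. -/
noncomputable def squareMinion : Minion where
  obj := fun D _ => SquareObj D
  map := fun α t =>
    { f := push α t.f
      g := push (Prod.map α α) t.g
      sum_f := by rw [sum_push, t.sum_f]
      sum_g := by rw [sum_push, t.sum_g]
      symm := fun c d hcd => by
        classical
        rw [push_prodMap_apply, push_prodMap_apply]
        conv_lhs => rw [add_comm, Finset.sum_comm, ← Finset.sum_add_distrib]
        simp only [push, Finset.sum_mul_sum]
        refine Finset.sum_congr rfl fun a ha => ?_
        rw [← Finset.sum_add_distrib]
        refine Finset.sum_congr rfl fun b hb => ?_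
        rw [add_comm]
        refine t.symm a b ?_
        rintro rfl
        simp only [Finset.mem_filter, Finset.mem_univ, true_and] at ha hb
        exact hcd (ha.symm.trans hb) }
  map_id := fun t => by
    apply SquareObj.ext
    · exact push_id _
    · simp only [Prod.map_id]
      exact push_id _
  map_comp := fun β α t => by
    apply SquareObj.ext
    · exact push_comp _ _ _
    · simp only [← Prod.map_comp_map]
      exact push_comp _ _ _

/-! ### CSP instances, templates, polymorphism minions -/

/-- A CSP instance with finitely many variables, each with its own finite domain, and a finite list
(indexed by `Con`) of constraints `scope c ∈ rel c`. -/
structure CSPInstance where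
  Var : Type
  [varFintype : Fintype Var]
  dom : Var → Type
  [domFintype : ∀ x, Fintype (dom x)]
  Con : Type
  [conFintype : Fintype Con]
  ar : Con → ℕ
  scope : (c : Con) → Fin (ar c) → Var
  rel : (c : Con) → Set ((i : Fin (ar c)) → dom (scope c i))

attribute [instance] CSPInstance.varFintype CSPInstance.domFintype CSPInstance.conFintype

namespace CSPInstance

/-- The instance has a solution. -/
def Solvable (I : CSPInstance) : Prop :=
  ∃ d : (x : I.Var) → I.dom x, ∀ c, (fun i => d (I.scope c i)) ∈ I.rel c

/-- The associated Label Cover instance: one new variable with domain `rel c` for each constraint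
`c`, and the projections as constraints. -/
noncomputable def lc (I : CSPInstance) : LCInstance where
  Var := I.Var ⊕ I.Con
  dom := Sum.elim I.dom (fun c => ↥(I.rel c))
  domFintype := fun y => match y with
    | Sum.inl x => I.domFintype x
    | Sum.inr c => Fintype.ofFinite ↥(I.rel c)
  Con := (c : I.Con) × Fin (I.ar c)
  tgt := fun p => Sum.inl (I.scope p.1 p.2)
  src := fun p => Sum.inr p.1
  fn := fun p r => r.1 p.2

/-- The instance with the domain of each variable `x` shrunk to `S x`. -/
noncomputable def restrict (I : CSPInstance) (S : (x : I.Var) → Set (I.dom x)) : CSPInstance where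
  Var := I.Var
  dom := fun x => ↥(S x)
  domFintype := fun _ => Fintype.ofFinite _
  Con := I.Con
  ar := I.ar
  scope := I.scope
  rel := fun c => {r | (fun i => (r i).1) ∈ I.rel c}

open Classical in
/-- One step of the singleton version of the algorithm with acceptance predicate `Acc`, at the
current domains `S`: for some variable `x` and some value `a` of its domain, the algorithm fails on
the instance with `x = a`, and `a` is removed from the domain of `x`. -/
def SinglStep (Acc : CSPInstance → Prop) (I : CSPInstance)
    (S T : (x : I.Var) → Set (I.dom x)) : Prop :=
  ∃ x, ∃ a ∈ S x, ¬ Acc (I.restrict (Function.update S x {a})) ∧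
    T = Function.update S x (S x \ {a})

/-- The singleton version of an algorithm accepts `I`: starting from the full domains, the pruning
process reaches domains that are all nonempty and cannot be pruned further. -/
def SinglAccepts (Acc : CSPInstance → Prop) (I : CSPInstance) : Prop :=
  ∃ S : (x : I.Var) → Set (I.dom x),
    Relation.ReflTransGen (SinglStep Acc I) (fun _ => Set.univ) S ∧
    (∀ x, (S x).Nonempty) ∧ ¬ ∃ T, SinglStep Acc I S T

end CSPInstance

/-- A finite relational structure; its signature is `Sym` with arities `ar`. -/
structure RelStructure where
  carrier : Type
  [carrierFintype : Fintype carrier]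
  Sym : Type
  ar : Sym → ℕ
  rel : (R : Sym) → Set (Fin (ar R) → carrier)

attribute [instance] RelStructure.carrierFintype

/-- An instance of the CSP over `A`: finitely many variables and a finite list of formal
constraints. -/
structure TemplateInstance (A : RelStructure) where
  Var : Type
  [varFintype : Fintype Var]
  Con : Type
  [conFintype : Fintype Con]
  sym : Con → A.Sym
  scope : (c : Con) → Fin (A.ar (sym c)) → Var

attribute [instance] TemplateInstance.varFintype TemplateInstance.conFintype

/-- The CSP instance obtained by interpreting the symbols in `A`. -/
def TemplateInstance.toCSP {A : RelStructure} (I : TemplateInstance A) : CSPInstance where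
  Var := I.Var
  dom := fun _ => A.carrier
  Con := I.Con
  ar := fun c => A.ar (I.sym c)
  scope := I.scope
  rel := fun c => A.rel (I.sym c)

/-- The relaxation described by `R` solves the CSP over `A`. -/
def Solves (R : Minion) (A : RelStructure) : Prop :=
  ∀ I : TemplateInstance A, I.toCSP.lc.SolvableIn R → I.toCSP.Solvable

/-- `F` is a homomorphism from the `D`-th power of `A` to `A`. -/
def IsPolymorphism (A : RelStructure) {D : Type} (F : (D → A.carrier) → A.carrier) : Prop :=
  ∀ (R : A.Sym) (t : D → Fin (A.ar R) → A.carrier), (∀ d, t d ∈ A.rel R) →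
    (fun i => F fun d => t d i) ∈ A.rel R

/-- The polymorphism minion of `A`. -/
def polMinion (A : RelStructure) : Minion where
  obj := fun D _ => {F : (D → A.carrier) → A.carrier // IsPolymorphism A F}
  map := fun α F => ⟨fun a => F.1 (a ∘ α), fun R t ht => F.2 R (t ∘ α) fun d => ht (α d)⟩
  map_id := fun _ => rfl
  map_comp := fun _ _ _ => rfl

/-! ### The templates associated with the dihedral group `D_4` -/

/-- The dihedral group with 8 elements. -/
abbrev D4 : Type := DihedralGroup 4

/-- `R` is a coset of a subgroup of `D_4^n`. -/
def IsCoset {n : ℕ} (R : Set (Fin n → D4)) : Prop :=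
  ∃ (H : Subgroup (Fin n → D4)) (g : Fin n → D4), R = {x | ∃ h ∈ H, x = g * h}

/-- The structure on `D_4` whose relations are all cosets of subgroups of `D_4^n`, for all
`n ≤ m`. -/
def cosetTemplate (m : ℕ∞) : RelStructure where
  carrier := D4
  Sym := (n : {n : ℕ // (n : ℕ∞) ≤ m}) × {R : Set (Fin n.1 → D4) // IsCoset R}
  ar := fun R => R.1.1
  rel := fun R => R.2.1

/-- The structure on `D_4` whose relations are all subgroups and all one-element subsets of
`D_4^n`, for all `n`. -/
def subgroupTemplate : RelStructure where
  carrier := D4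
  Sym := (n : ℕ) × {R : Set (Fin n → D4) //
    (∃ H : Subgroup (Fin n → D4), R = H) ∨ ∃ g, R = {g}}
  ar := fun R => R.1
  rel := fun R => R.2.1

/-! ### The combination BLP+AIP -/

/-- A probability distribution on `D` together with an integer affine distribution on `D` that
vanishes wherever the former does. -/
@[ext]
structure BLPAIPObj (D : Type) [Fintype D] where
  blp : D → ℝ
  aip : D → ℤ
  nonneg : ∀ a, 0 ≤ blp a
  sum_blp : ∑ a, blp a = 1
  sum_aip : ∑ a, aip a = 1
  support : ∀ a, blp a = 0 → aip a = 0

/-- The minion describing BLP+AIP. -/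
noncomputable def blpAipMinion : Minion where
  obj := fun D _ => BLPAIPObj D
  map := fun α t =>
    { blp := push α t.blp
      aip := push α t.aip
      nonneg := fun b => by
        classical
        exact Finset.sum_nonneg fun a _ => t.nonneg a
      sum_blp := by rw [sum_push, t.sum_blp]
      sum_aip := by rw [sum_push, t.sum_aip]
      support := fun b hb => by
        classical
        simp only [push] at hb ⊢
        rw [Finset.sum_eq_zero_iff_of_nonneg fun a _ => t.nonneg a] at hb
        exact Finset.sum_eq_zero fun a ha => t.support a (hb a ha) }
  map_id := fun t => by
    apply BLPAIPObj.ext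
    · exact push_id _
    · exact push_id _
  map_comp := fun β α t => by
    apply BLPAIPObj.ext
    · exact push_comp _ _ _
    · exact push_comp _ _ _

/-- BLP+AIP accepts the CSP instance `I`. -/
def BLPAIPAccepts (I : CSPInstance) : Prop := I.lc.SolvableIn blpAipMinion

end SolvingSquare

/-!
Identify `D_4` with the unitriangular `3 × 3` matrices over `Z_2`, with coordinates `p, q` next to
the diagonal and `z` in the corner, so that multiplication is `z(xy) = z(x) + z(y) + p(x) q(y)`. A
word in the letters `D`, evaluated in `D_4`, then depends only on the parities `f a` of the numbers
of occurrences of `a` and the parities `g (a, b)` of the numbers of pairs of an `a` followed by a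
`b`. The polymorphisms of `D_4` with all subgroups are exactly these word functions subject to the
conditions coming from the constants, and those of `D_4` with all cosets are the ones for which
moreover the rows of `g` sum up to zero. Changing the diagonal of `g` achieves the latter and
commutes with minor maps.

If `v` is a family of orthogonal vectors, then by `(*)` the weights and the `Q`-Gram matrix of `v`
satisfy the relation between `f` and `g` off the diagonal. For the second level of the `Z_2`
relaxation, the values at the pairs of variables are regarded as inner products between formal
vectors, and a symmetric form on a finite-dimensional space minus a product of linear forms can be
written as `Q + Qᵗ` once it is alternating; this provides the form used for rounding.

Singl(BLP+AIP) is fooled by two copies of a system of equations that forces two variables of the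
copy to agree, linked by an equation asking for disagreement in exactly one copy. Fixing one value
only concerns one of the copies, and the other one has a relaxed solution in which the two
variables disagree.
-/

namespace SolvingSquare

/-! ### Summing up along a function -/

section Push

variable {D E M : Type} [Fintype D]

section AddCommMonoid

variable [AddCommMonoid M]

theorem push_apply [DecidableEq E] (α : D → E) (f : D → M) (b : E) :
    push α f b = ∑ a with α a = b, f a := by
  rw [push]
  congr

theorem push_apply_eq_sum_ite [DecidableEq E] (α : D → E) (f : D → M) (b : E) :
    push α f b = ∑ a, if α a = b then f a else 0 := by
  rw [push_apply, Finset.sum_filter]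

theorem push_const (α : D → E) (m : M) (b : E) [DecidableEq E] :
    push α (fun _ => m) b = (Finset.univ.filter fun a => α a = b).card • m := by
  rw [push_apply, Finset.sum_const]

theorem map_push {N : Type} [AddCommMonoid N] (φ : M →+ N) (α : D → E) (f : D → M) (b : E) :
    φ (push α f b) = push α (φ ∘ f) b :=
  map_sum φ _ _

theorem push_apply_eq_zero {α : D → E} {f : D → M} {b : E} (h : ∀ a, α a = b → f a = 0) :
    push α f b = 0 :=
  Finset.sum_eq_zero fun a ha => h a (by simpa using ha)

theorem push_apply_eq_push_comp {D' E' : Type} [Fintype D'] {α : D → E} {b : E} {α' : D' → E'}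
    {b' : E'} {j : D' → D} (hj : j.Injective) (h : ∀ a', α (j a') = b ↔ α' a' = b') (f : D → M)
    (hf : ∀ a, α a = b → a ∉ Set.range j → f a = 0) : push α f b = push α' (f ∘ j) b' := by
  classical
  rw [push_apply, push_apply]
  refine (Finset.sum_of_injOn j hj.injOn ?_ ?_ fun _ _ => rfl).symm
  · intro a' ha'
    simpa [h] using ha'
  · intro a ha ha'
    refine hf a (by simpa using ha) ?_
    rintro ⟨a', rfl⟩
    exact ha' ⟨a', by simpa [h] using ha, rfl⟩

theorem push_apply_of_injective {α : D → E} (hα : α.Injective) (f : D → M) (a : D) :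
    push α f (α a) = f a := by
  classical
  simp [push_apply_eq_sum_ite, hα.eq_iff]

end AddCommMonoid

theorem push_sub [AddCommGroup M] (α : D → E) (f g : D → M) :
    push α (f - g) = push α f - push α g := by
  ext b
  exact Finset.sum_sub_distrib _ _

theorem sum_push_mul [NonUnitalNonAssocSemiring M] [Fintype E] (α : D → E) (f : D → M)
    (h : E → M) : ∑ b, push α f b * h b = ∑ a, f a * h (α a) := by
  classical
  simp only [push_apply_eq_sum_ite, Finset.sum_mul, ite_mul, zero_mul]
  rw [Finset.sum_comm]
  simp

end Push

/-! ### Minions, homomorphisms and relaxations -/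

namespace MinionHom

variable {R S T : Minion}

/-- The composition `η ∘ ξ`. -/
def comp (η : MinionHom S T) (ξ : MinionHom R S) : MinionHom R T where
  app D _ r := η.app D (ξ.app D r)
  naturality α r := by rw [ξ.naturality, η.naturality]

/-- The inverse of a homomorphism all of whose components are bijective. -/
noncomputable def symm (η : MinionHom R S)
    (hη : ∀ (D : Type) [Fintype D], (η.app D).Bijective) : MinionHom S R where
  app D _ := (Equiv.ofBijective _ (hη D)).symm
  naturality {D E} _ _ α s := by
    rw [Equiv.symm_apply_eq, Equiv.ofBijective_apply, η.naturality]
    exact congrArg _ (Equiv.ofBijective_apply_symm_apply _ (hη D) _).symm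

theorem symm_bijective (η : MinionHom R S) (hη : ∀ (D : Type) [Fintype D], (η.app D).Bijective)
    (D : Type) [Fintype D] : ((η.symm hη).app D).Bijective :=
  (Equiv.ofBijective _ (hη D)).symm.bijective

end MinionHom

theorem Minion.map_eq_map_of_comp_left (R : Minion) {K D E : Type} [Fintype K] [Fintype D]
    [Fintype E] [Nonempty K] {j : D → E} (hj : j.Injective) {α β : K → D} {r : R.obj K}
    (h : R.map (j ∘ α) r = R.map (j ∘ β) r) : R.map α r = R.map β r := by
  have : Nonempty D := ‹Nonempty K›.map α
  have hinv (γ : K → D) : R.map γ r = R.map (Function.invFun j) (R.map (j ∘ γ) r) := by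
    rw [← R.map_comp, ← Function.comp_assoc, Function.invFun_comp hj, Function.id_comp]
  rw [hinv α, h, ← hinv β]

namespace LCInstance

variable {D : LCInstance} {R S : Minion}

theorem SolvableIn.map (h : D.SolvableIn R) (ξ : MinionHom R S) : D.SolvableIn S := by
  obtain ⟨s, hs⟩ := h
  exact ⟨fun x => ξ.app _ (s x), fun c => by simp only [hs c, ξ.naturality]⟩

theorem solvableIn_of_map_eq {K : Type} [Fintype K] (r : R.obj K) (A : ∀ x, K → D.dom x)
    (h : ∀ c, R.map (A (D.tgt c)) r = R.map (D.fn c ∘ A (D.src c)) r) : D.SolvableIn R :=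
  ⟨fun x => R.map (A x) r, fun c => (h c).trans (R.map_comp _ _ r)⟩

/-- A solution of the instance itself: a value for each variable such that all constraints hold. -/
def IsAssignment (D : LCInstance) (d : ∀ x, D.dom x) : Prop :=
  ∀ c, d (D.tgt c) = D.fn c (d (D.src c))

theorem IsAssignment.solvableIn {d : ∀ x, D.dom x} (hd : D.IsAssignment d) (r : R.obj Unit) :
    D.SolvableIn R :=
  solvableIn_of_map_eq r (fun x _ => d x) fun c => by rw [hd c]; rfl

theorem IsAssignment.addId {d : ∀ x, D.dom x} (hd : D.IsAssignment d) : D.addId.IsAssignment d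
  | .inl c => hd c
  | .inr _ => rfl

theorem IsAssignment.satPower {d : ∀ x, D.dom x} (hd : D.IsAssignment d) (k : ℕ) :
    (D.satPower k).IsAssignment fun x i => d (x i)
  | .inl c => funext fun i => hd.addId (c i)
  | .inr _ => rfl

end LCInstance

theorem CSPInstance.Solvable.exists_isAssignment_lc {I : CSPInstance} (h : I.Solvable) :
    ∃ d, I.lc.IsAssignment d := by
  obtain ⟨d, hd⟩ := h
  exact ⟨fun | .inl x => d x | .inr c => ⟨_, hd c⟩, fun _ => rfl⟩

theorem solves_polMinion (A : RelStructure) : Solves (polMinion A) A := by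
  rintro I ⟨s, hs⟩
  have hvar (c i) : (s (.inl (I.scope c i))).1 id = (s (.inr c)).1 fun r => r.1 i :=
    congrFun (congrArg Subtype.val (hs ⟨c, i⟩)) id
  refine ⟨fun x => (s (.inl x)).1 id, fun c => ?_⟩
  have hrel := (s (.inr c)).2 (I.sym c) (fun r => r.1) fun r => r.2
  rwa [← funext (hvar c)] at hrel

theorem Solves.of_hom {R S : Minion} {A : RelStructure} (hS : Solves S A) (ξ : MinionHom R S) :
    Solves R A :=
  fun I h => hS I (h.map ξ)

/-! ### Coordinates on the dihedral group -/

namespace D4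

/-- The first coordinate of an element of `D_4`. The coordinates `p, q, z` identify `D_4` with the
unitriangular `3 × 3` matrices over `Z_2`, `p` and `q` being the entries next to the diagonal and
`z` the corner entry. -/
def coordP : D4 → ZMod 2
  | .r i => (![0, 1, 0, 1] : Fin 4 → ZMod 2) i
  | .sr i => (![1, 0, 1, 0] : Fin 4 → ZMod 2) i

/-- The second coordinate of an element of `D_4`, see `coordP`. -/
def coordQ : D4 → ZMod 2
  | .r i => (![0, 1, 0, 1] : Fin 4 → ZMod 2) i
  | .sr i => (![0, 1, 0, 1] : Fin 4 → ZMod 2) i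

/-- The third, central coordinate of an element of `D_4`, see `coordP`. -/
def coordZ : D4 → ZMod 2
  | .r i => (![0, 1, 1, 0] : Fin 4 → ZMod 2) i
  | .sr i => (![0, 0, 1, 1] : Fin 4 → ZMod 2) i

/-- The element of `D_4` with the given coordinates, see `coordP`. -/
def ofCoords (p q z : ZMod 2) : D4 :=
  .sr 1 ^ q.val * .sr 0 ^ p.val * .r 2 ^ z.val

@[simp]
theorem coordP_ofCoords (p q z : ZMod 2) : coordP (ofCoords p q z) = p := by
  decide +revert

@[simp]
theorem coordQ_ofCoords (p q z : ZMod 2) : coordQ (ofCoords p q z) = q := by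
  decide +revert

@[simp]
theorem coordZ_ofCoords (p q z : ZMod 2) : coordZ (ofCoords p q z) = z := by
  decide +revert

@[simp]
theorem coordP_one : coordP 1 = 0 := rfl

@[simp]
theorem coordQ_one : coordQ 1 = 0 := rfl

@[simp]
theorem coordZ_one : coordZ 1 = 0 := rfl

@[simp]
theorem coordP_mul (x y : D4) : coordP (x * y) = coordP x + coordP y := by
  decide +revert

@[simp]
theorem coordQ_mul (x y : D4) : coordQ (x * y) = coordQ x + coordQ y := by
  decide +revert

@[simp]
theorem coordZ_mul (x y : D4) :
    coordZ (x * y) = coordZ x + coordZ y + coordP x * coordQ y := by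
  decide +revert

@[simp]
theorem coordP_inv (x : D4) : coordP x⁻¹ = coordP x := by
  decide +revert

@[simp]
theorem coordQ_inv (x : D4) : coordQ x⁻¹ = coordQ x := by
  decide +revert

@[simp]
theorem coordZ_inv (x : D4) : coordZ x⁻¹ = coordZ x + coordP x * coordQ x := by
  decide +revert

theorem ext_coords {x y : D4} (hp : coordP x = coordP y) (hq : coordQ x = coordQ y)
    (hz : coordZ x = coordZ y) : x = y := by
  decide +revert

end D4

/-! ### Evaluating pairs `(f, g)` as words -/

open D4
open scoped commutatorElement

/-- The ambient group of all pairs `(f, g)`, in which the words over the alphabet `D` are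
represented: `f d` counts the occurrences of the letter `d` modulo `2`, and `g (a, b)` counts the
pairs of an occurrence of `a` followed by an occurrence of `b`. -/
@[ext]
structure TermPair (D : Type) where
  f : D → ZMod 2
  g : D × D → ZMod 2

namespace TermPair

variable {D E : Type}

instance : One (TermPair D) := ⟨⟨0, 0⟩⟩

/-- Concatenation of words. -/
instance : Mul (TermPair D) := ⟨fun u v => ⟨u.f + v.f, u.g + v.g + fun q => u.f q.1 * v.f q.2⟩⟩

instance : Inv (TermPair D) := ⟨fun u => ⟨u.f, u.g + fun q => u.f q.1 * u.f q.2⟩⟩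

@[simp]
theorem f_one : (1 : TermPair D).f = 0 := rfl

@[simp]
theorem g_one : (1 : TermPair D).g = 0 := rfl

@[simp]
theorem f_mul (u v : TermPair D) : (u * v).f = u.f + v.f := rfl

@[simp]
theorem g_mul (u v : TermPair D) (q : D × D) :
    (u * v).g q = u.g q + v.g q + u.f q.1 * v.f q.2 := rfl

@[simp]
theorem f_inv (u : TermPair D) : u⁻¹.f = u.f := rfl

@[simp]
theorem g_inv (u : TermPair D) (q : D × D) : u⁻¹.g q = u.g q + u.f q.1 * u.f q.2 := rfl

instance : Group (TermPair D) :=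
  Group.ofLeftAxioms
    (fun u v w => by
      ext q
      · simp [add_assoc]
      · simp only [g_mul, f_mul, Pi.add_apply]
        ring)
    (fun u => by ext <;> simp)
    (fun u => by
      ext q
      · simp [CharTwo.add_self_eq_zero]
      · simp only [g_mul, g_inv, f_inv, g_one, Pi.zero_apply]
        grind)

/-- The one-letter word. -/
def of [DecidableEq D] (d : D) : TermPair D := ⟨Pi.single d 1, 0⟩

/-- The word map `x ↦ w(x)` on `D_4` represented by a pair `w`, as a homomorphism in `w`. -/
def eval [Fintype D] (x : D → D4) : TermPair D →* D4 where
  toFun w := ofCoords (∑ d, w.f d * coordP (x d)) (∑ d, w.f d * coordQ (x d))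
    (∑ d, w.f d * coordZ (x d) + ∑ q, w.g q * (coordP (x q.1) * coordQ (x q.2)))
  map_one' := by simp; rfl
  map_mul' u v := by
    apply ext_coords
    · simp [add_mul, Finset.sum_add_distrib]
    · simp [add_mul, Finset.sum_add_distrib]
    · have h : ∑ q : D × D, u.f q.1 * v.f q.2 * (coordP (x q.1) * coordQ (x q.2))
          = (∑ a, u.f a * coordP (x a)) * ∑ b, v.f b * coordQ (x b) := by
        rw [Finset.sum_mul_sum, ← Finset.univ_product_univ, Finset.sum_product]
        exact Finset.sum_congr rfl fun a _ => Finset.sum_congr rfl fun b _ => by ring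
      simp only [f_mul, g_mul, Pi.add_apply, add_mul, Finset.sum_add_distrib, coordZ_ofCoords,
        coordZ_mul, coordP_ofCoords, coordQ_ofCoords, h]
      ring

section Eval

variable [Fintype D] (x : D → D4) (w : TermPair D)

@[simp]
theorem coordP_eval : coordP (eval x w) = ∑ d, w.f d * coordP (x d) := by
  simp [eval]

@[simp]
theorem coordQ_eval : coordQ (eval x w) = ∑ d, w.f d * coordQ (x d) := by
  simp [eval]

@[simp]
theorem coordZ_eval : coordZ (eval x w) =
    ∑ d, w.f d * coordZ (x d) + ∑ q, w.g q * (coordP (x q.1) * coordQ (x q.2)) := by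
  simp [eval]

@[simp]
theorem eval_of [DecidableEq D] (d : D) : eval x (of d) = x d :=
  ext_coords (by simp [of, Pi.single_apply]) (by simp [of, Pi.single_apply])
    (by simp [of, Pi.single_apply])

theorem eval_push [Fintype E] (α : D → E) (y : E → D4) :
    eval y ⟨push α w.f, push (Prod.map α α) w.g⟩ = eval (y ∘ α) w :=
  ext_coords (by simp [sum_push_mul]) (by simp [sum_push_mul])
    (by simp [sum_push_mul _ _ fun e => coordZ (y e),
      sum_push_mul _ _ fun q : E × E => coordP (y q.1) * coordQ (y q.2)])

theorem eval_injective : Function.Injective fun (w : TermPair D) (x : D → D4) => eval x w := by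
  classical
  intro u v h
  have hcoord (φ : D4 → ZMod 2) (x : D → D4) : φ (eval x u) = φ (eval x v) :=
    congrArg φ (congrFun h x)
  ext q
  · simpa using hcoord coordP fun d => ofCoords (if d = q then 1 else 0) 0 0
  · have hq (a : D × D) : a.2 = q.2 ∧ a.1 = q.1 ↔ a = q := by rw [Prod.ext_iff, and_comm]
    simpa [← ite_and, hq] using hcoord coordZ fun d =>
      ofCoords (if d = q.1 then 1 else 0) (if d = q.2 then 1 else 0) 0

theorem eval_const_eq_iff {w : TermPair D} :
    (∀ y, eval (fun _ => y) w = y) ↔ ∑ d, w.f d = 1 ∧ ∑ q, w.g q = 0 := by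
  constructor
  · intro h
    have hz : ∑ d, w.f d = 1 := by
      simpa using congrArg coordZ (h (ofCoords 0 0 1))
    exact ⟨hz, by simpa using congrArg coordZ (h (ofCoords 1 1 0))⟩
  · rintro ⟨hf, hg⟩ y
    apply ext_coords <;> simp [← Finset.sum_mul, hf, hg]

end Eval

/-- The pairs `(f, g)` represented by words, see `closure_range_of`. -/
def wordSubgroup (D : Type) : Subgroup (TermPair D) where
  carrier := {w | ∀ a b, a ≠ b → w.g (a, b) + w.g (b, a) = w.f a * w.f b}
  one_mem' := by simp
  mul_mem' {u v} hu hv a b hab := by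
    simp only [g_mul, f_mul, Pi.add_apply]
    linear_combination hu a b hab + hv a b hab
  inv_mem' {u} hu a b hab := by
    simp only [g_inv, f_inv]
    linear_combination hu a b hab + u.f a * u.f b * CharTwo.two_eq_zero (R := ZMod 2)

/-- The central pair `(0, g)` with `g (a, b) = h {a, b}`. -/
def symmetric (h : Sym2 D → ZMod 2) : TermPair D := ⟨0, fun q => h s(q.1, q.2)⟩

theorem symmetric_add (h h' : Sym2 D → ZMod 2) :
    symmetric (h + h') = symmetric h * symmetric h' := by
  ext <;> simp [symmetric]

section DecidableEq

variable [DecidableEq D]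

theorem of_mem_wordSubgroup (d : D) : of d ∈ wordSubgroup D := by
  intro a b hab
  simp only [of, Pi.zero_apply, Pi.single_apply, add_zero]
  grind

theorem symmetric_single_diag (a : D) : symmetric (Pi.single s(a, a) 1) = of a * of a := by
  ext q
  · simp [symmetric, of, CharTwo.add_self_eq_zero]
  · simp only [symmetric, of, g_mul, Pi.single_apply, Sym2.eq_iff, Pi.zero_apply]
    grind

theorem symmetric_single_of_ne {a b : D} (hab : a ≠ b) :
    symmetric (Pi.single s(a, b) 1) = ⁅of a, of b⁆ := by
  ext q <;>
  · simp only [commutatorElement_def, symmetric, of, g_mul, f_mul, g_inv, f_inv, Pi.single_apply,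
      Sym2.eq_iff, Pi.zero_apply, Pi.add_apply]
    grind

variable [Finite D]

theorem symmetric_mem_closure (h : Sym2 D → ZMod 2) :
    symmetric h ∈ Subgroup.closure (Set.range (of : D → TermPair D)) := by
  have hof (d : D) : of d ∈ Subgroup.closure (Set.range (of : D → TermPair D)) :=
    Subgroup.subset_closure ⟨d, rfl⟩
  induction h using Pi.single_induction with
  | zero => exact one_mem _
  | add h h' ih ih' => exact symmetric_add h h' ▸ mul_mem ih ih'
  | single e c =>
    obtain rfl | rfl : c = 0 ∨ c = 1 := by decide +revert
    · rw [Pi.single_zero]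
      exact one_mem _
    · induction e using Sym2.ind with | _ a b
      rcases eq_or_ne a b with rfl | hab
      · exact symmetric_single_diag a ▸ mul_mem (hof a) (hof a)
      · rw [symmetric_single_of_ne hab, commutatorElement_def]
        exact mul_mem (mul_mem (mul_mem (hof a) (hof b)) (inv_mem (hof a))) (inv_mem (hof b))

theorem exists_mem_closure_f_eq (f : D → ZMod 2) :
    ∃ w ∈ Subgroup.closure (Set.range (of : D → TermPair D)), w.f = f := by
  induction f using Pi.single_induction with
  | zero => exact ⟨1, one_mem _, rfl⟩
  | add f f' ih ih' =>
    obtain ⟨⟨u, hu, rfl⟩, v, hv, rfl⟩ := And.intro ih ih'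
    exact ⟨u * v, mul_mem hu hv, rfl⟩
  | single d c =>
    obtain rfl | rfl : c = 0 ∨ c = 1 := by decide +revert
    · exact ⟨1, one_mem _, (Pi.single_zero d).symm⟩
    · exact ⟨of d, Subgroup.subset_closure ⟨d, rfl⟩, rfl⟩

theorem closure_range_of : Subgroup.closure (Set.range of) = wordSubgroup D := by
  have hle : Subgroup.closure (Set.range of) ≤ wordSubgroup D :=
    (Subgroup.closure_le _).2 <| Set.range_subset_iff.2 of_mem_wordSubgroup
  refine le_antisymm hle fun w hw => ?_
  obtain ⟨u, hu, huw⟩ := exists_mem_closure_f_eq w.f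
  have hf : (u⁻¹ * w).f = 0 := by
    ext d
    simp [huw, CharTwo.add_self_eq_zero]
  have hmem : u⁻¹ * w ∈ wordSubgroup D := mul_mem (inv_mem (hle hu)) hw
  have hg (a b : D) : (u⁻¹ * w).g (a, b) = (u⁻¹ * w).g (b, a) := by
    rcases eq_or_ne a b with rfl | hab
    · rfl
    rw [← CharTwo.add_eq_zero, hmem a b hab, hf, Pi.zero_apply, zero_mul]
  have hsymm : u⁻¹ * w = symmetric (Sym2.lift ⟨fun a b => (u⁻¹ * w).g (a, b), hg⟩) :=
    TermPair.ext hf rfl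
  rw [← mul_inv_cancel_left u w, hsymm]
  exact mul_mem hu (symmetric_mem_closure _)

end DecidableEq

variable {ι : Type} [Fintype D]

/-- Coordinatewise evaluation in a power of `D_4`. -/
def evalPi (t : D → ι → D4) : TermPair D →* (ι → D4) :=
  MonoidHom.pi fun i => eval fun d => t d i

theorem map_evalPi_wordSubgroup (t : D → ι → D4) :
    (wordSubgroup D).map (evalPi t) = Subgroup.closure (Set.range t) := by
  classical
  rw [← closure_range_of, MonoidHom.map_closure, ← Set.range_comp]
  congr 2
  ext d i
  exact eval_of _ d

theorem isPolymorphism_subgroupTemplate_eval {w : TermPair D} (hw : w ∈ wordSubgroup D)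
    (hconst : ∀ y, eval (fun _ => y) w = y) :
    IsPolymorphism subgroupTemplate fun x => eval x w := by
  rintro ⟨n, R, ⟨H, rfl⟩ | ⟨y, rfl⟩⟩ t ht
  · have hle : (wordSubgroup D).map (evalPi t) ≤ H :=
      map_evalPi_wordSubgroup t ▸ (Subgroup.closure_le H).2 (Set.range_subset_iff.2 ht)
    exact hle (Subgroup.mem_map_of_mem _ hw)
  · obtain rfl : t = fun _ => y := funext ht
    exact funext fun i => hconst (y i)

end TermPair

namespace IsPolymorphism

variable {D ι : Type} {F : (D → D4) → D4}

theorem subgroupTemplate_const (hF : IsPolymorphism subgroupTemplate F) (y : D4) :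
    F (fun _ => y) = y :=
  congrFun (hF ⟨1, {fun _ => y}, .inr ⟨_, rfl⟩⟩ (fun _ _ => y) fun _ => rfl) (0 : Fin 1)

theorem subgroupTemplate_mem [Finite ι] (hF : IsPolymorphism subgroupTemplate F)
    (H : Subgroup (ι → D4)) {t : D → ι → D4} (ht : ∀ d, t d ∈ H) :
    (fun i => F fun d => t d i) ∈ H := by
  obtain ⟨n, ⟨e⟩⟩ := Finite.exists_equiv_fin ι
  let reindex : (Fin n → D4) →* (ι → D4) := MonoidHom.pi fun i => Pi.evalMonoidHom _ (e i)
  have hreindex (x : ι → D4) : reindex (x ∘ e.symm) = x :=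
    funext fun i => congrArg x (e.symm_apply_apply i)
  have hmem : reindex ((fun i => F fun d => t d i) ∘ e.symm) ∈ H :=
    hF ⟨n, H.comap reindex, .inl ⟨_, rfl⟩⟩ (fun d => t d ∘ e.symm) fun d => by
      change reindex (t d ∘ e.symm) ∈ H
      rw [hreindex]
      exact ht d
  rwa [hreindex] at hmem

open TermPair in
theorem exists_eq_eval [Fintype D] (hF : IsPolymorphism subgroupTemplate F) :
    ∃ w ∈ wordSubgroup D, F = fun x => eval x w := by
  have hmem : F ∈ Subgroup.closure (Set.range fun d (x : D → D4) => x d) :=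
    hF.subgroupTemplate_mem _ fun d => Subgroup.subset_closure ⟨d, rfl⟩
  rw [← map_evalPi_wordSubgroup] at hmem
  obtain ⟨w, hw, rfl⟩ := hmem
  exact ⟨w, hw, rfl⟩

end IsPolymorphism

open TermPair

/-- The pair `(f, g)` underlying an element of `M`. -/
def SquareObj.toTermPair {D : Type} [Fintype D] (s : SquareObj D) : TermPair D := ⟨s.f, s.g⟩

theorem SquareObj.isPolymorphism_eval {D : Type} [Fintype D] (s : SquareObj D) :
    IsPolymorphism subgroupTemplate fun x => eval x s.toTermPair :=
  isPolymorphism_subgroupTemplate_eval s.symm <| eval_const_eq_iff.2 ⟨s.sum_f, s.sum_g⟩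

/-- The homomorphism from `M` to `Pol(D')` that evaluates pairs `(f, g)` as words. -/
noncomputable def squareToPol : MinionHom squareMinion (polMinion subgroupTemplate) where
  app _ _ s := ⟨_, s.isPolymorphism_eval⟩
  naturality α s := Subtype.ext <| funext fun y => eval_push s.toTermPair α y

theorem squareToPol_bijective (D : Type) [Fintype D] :
    Function.Bijective (squareToPol.app D) := by
  constructor
  · intro s s' h
    have hw : s.toTermPair = s'.toTermPair := eval_injective (congrArg Subtype.val h)
    exact SquareObj.ext (congrArg TermPair.f hw) (congrArg TermPair.g hw)
  · rintro ⟨F, hF⟩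
    obtain ⟨w, hw, rfl⟩ := hF.exists_eq_eval
    have hsum := eval_const_eq_iff.1 hF.subgroupTemplate_const
    exact ⟨⟨w.f, w.g, hsum.1, hsum.2, hw⟩, rfl⟩

theorem isCoset_coe {n : ℕ} (H : Subgroup (Fin n → D4)) : IsCoset (H : Set (Fin n → D4)) :=
  ⟨H, 1, by simp⟩

theorem isCoset_singleton {n : ℕ} (g : Fin n → D4) : IsCoset {g} :=
  ⟨⊥, g, by simp⟩

theorem isCoset_graph_mul_left (y : D4) : IsCoset {z : Fin 2 → D4 | z 1 = y * z 0} := by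
  refine ⟨(MonoidHom.pi fun _ => MonoidHom.id D4).range, ![1, y], ?_⟩
  ext z
  constructor
  · intro hz
    refine ⟨fun _ => z 0, ⟨z 0, rfl⟩, funext <| Fin.forall_fin_two.2 ⟨?_, hz⟩⟩
    simp
  · rintro ⟨_, ⟨x, rfl⟩, rfl⟩
    simp

namespace IsPolymorphism

variable {D : Type} {F : (D → D4) → D4}

theorem cosetTemplate_of_top (hF : IsPolymorphism (cosetTemplate ⊤) F) (m : ℕ∞) :
    IsPolymorphism (cosetTemplate m) F :=
  fun R => hF ⟨⟨R.1.1, le_top⟩, R.2⟩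

theorem subgroupTemplate_of_coset (hF : IsPolymorphism (cosetTemplate ⊤) F) :
    IsPolymorphism subgroupTemplate F := by
  rintro ⟨n, R, hR⟩
  refine hF ⟨⟨n, le_top⟩, R, ?_⟩
  obtain ⟨H, rfl⟩ | ⟨g, rfl⟩ := hR
  · exact isCoset_coe H
  · exact isCoset_singleton g

end IsPolymorphism

theorem isPolymorphism_cosetTemplate_top_iff {D : Type} {F : (D → D4) → D4} :
    IsPolymorphism (cosetTemplate ⊤) F ↔
      IsPolymorphism subgroupTemplate F ∧ ∀ y x, F (fun d => y * x d) = y * F x := by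
  refine ⟨fun hF => ⟨hF.subgroupTemplate_of_coset, fun y x => ?_⟩, ?_⟩
  · exact hF ⟨⟨2, le_top⟩, _, isCoset_graph_mul_left y⟩ (fun d => ![x d, y * x d]) fun d => rfl
  · rintro ⟨hF, hmul⟩ ⟨n, _, H, g, rfl⟩ t ht
    choose h hH ht using ht
    refine ⟨fun i => F fun d => h d i, hF.subgroupTemplate_mem H hH, funext fun i => ?_⟩
    exact (congrArg F (funext fun d => congrFun (ht d) i)).trans (hmul (g i) fun d => h d i)

namespace SquareObj

variable {D : Type} [Fintype D] (s : SquareObj D)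

theorem sum_col_eq_sum_row (a : D) : ∑ b, s.g (b, a) = ∑ b, s.g (a, b) := by
  classical
  rw [eq_comm, ← CharTwo.add_eq_zero, ← Finset.sum_add_distrib]
  have hsymm (b : D) : s.g (a, b) + s.g (b, a) = s.f a * s.f b - if b = a then s.f a else 0 := by
    split_ifs with hab
    · rw [hab, CharTwo.add_self_eq_zero, ← sq, ZMod.pow_card, sub_self]
    · rw [s.symm a b (Ne.symm hab), sub_zero]
  simp [hsymm, ← Finset.mul_sum, s.sum_f]

theorem coordZ_eval_mul_left (y : D4) (x : D → D4) :
    coordZ (eval (fun d => y * x d) s.toTermPair) = coordZ (y * eval x s.toTermPair) +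
      ∑ a, (∑ b, s.g (a, b)) * (coordP y * coordQ (x a) + coordQ y * coordP (x a)) := by
  have hf : ∑ a, s.f a * coordZ (y * x a) =
      coordZ y + ∑ a, s.f a * coordZ (x a) + coordP y * ∑ a, s.f a * coordQ (x a) := by
    simp [mul_add, Finset.sum_add_distrib, ← Finset.sum_mul, s.sum_f, Finset.mul_sum,
      mul_left_comm]
  have hg : ∑ q, s.g q * (coordP (y * x q.1) * coordQ (y * x q.2)) =
      ∑ q, s.g q * (coordP (x q.1) * coordQ (x q.2)) +
        (coordP y * ∑ q, s.g q * coordQ (x q.2) + coordQ y * ∑ q, s.g q * coordP (x q.1)) := by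
    have hexpand (q : D × D) : s.g q * (coordP (y * x q.1) * coordQ (y * x q.2)) =
        s.g q * (coordP (x q.1) * coordQ (x q.2)) + (coordP y * (s.g q * coordQ (x q.2)) +
          coordQ y * (s.g q * coordP (x q.1))) + coordP y * coordQ y * s.g q := by
      rw [coordP_mul, coordQ_mul]
      ring
    simp only [hexpand, Finset.sum_add_distrib, ← Finset.mul_sum, s.sum_g, mul_zero, add_zero]
  have hrow : ∑ q, s.g q * coordP (x q.1) = ∑ a, (∑ b, s.g (a, b)) * coordP (x a) := by
    simp only [Fintype.sum_prod_type, Finset.sum_mul]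
  have hcol : ∑ q, s.g q * coordQ (x q.2) = ∑ a, (∑ b, s.g (a, b)) * coordQ (x a) := by
    simp only [← s.sum_col_eq_sum_row, Fintype.sum_prod_type_right, Finset.sum_mul]
  have hshift : ∑ a, (∑ b, s.g (a, b)) * (coordP y * coordQ (x a) + coordQ y * coordP (x a)) =
      coordP y * ∑ q, s.g q * coordQ (x q.2) + coordQ y * ∑ q, s.g q * coordP (x q.1) := by
    simp only [hrow, hcol, mul_add, Finset.sum_add_distrib, mul_left_comm _ (coordP y),
      mul_left_comm _ (coordQ y), ← Finset.mul_sum]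
  rw [coordZ_mul, coordZ_eval, coordZ_eval, coordQ_eval, hshift]
  simp only [toTermPair, hf, hg]
  ring

theorem eval_mul_left (y : D4) (x : D → D4) :
    eval (fun d => y * x d) s.toTermPair = y * eval x s.toTermPair * ofCoords 0 0
      (∑ a, (∑ b, s.g (a, b)) * (coordP y * coordQ (x a) + coordQ y * coordP (x a))) := by
  apply ext_coords
  · simp [mul_add, Finset.sum_add_distrib, ← Finset.sum_mul, toTermPair, s.sum_f]
  · simp [mul_add, Finset.sum_add_distrib, ← Finset.sum_mul, toTermPair, s.sum_f]
  · rw [coordZ_eval_mul_left, coordZ_mul _ (ofCoords _ _ _), coordZ_ofCoords, coordQ_ofCoords,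
      mul_zero, add_zero]

theorem eval_mul_left_eq_iff :
    (∀ y x, eval (fun d => y * x d) s.toTermPair = y * eval x s.toTermPair) ↔
      ∀ a, ∑ b, s.g (a, b) = 0 := by
  classical
  refine ⟨fun h a => ?_, fun h y x => ?_⟩
  · simpa [eval_mul_left] using
      congrArg coordZ (h (ofCoords 1 0 0) fun d => ofCoords 0 (if d = a then 1 else 0) 0)
  · rw [eval_mul_left]
    apply ext_coords <;> simp [h]

theorem isPolymorphism_cosetTemplate_top_iff :
    IsPolymorphism (cosetTemplate ⊤) (fun x => eval x s.toTermPair) ↔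
      ∀ a, ∑ b, s.g (a, b) = 0 :=
  SolvingSquare.isPolymorphism_cosetTemplate_top_iff.trans <|
    (and_iff_right s.isPolymorphism_eval).trans s.eval_mul_left_eq_iff

end SquareObj

/-- The homomorphism `Pol(D_∞) → M` obtained by restricting the isomorphism `Pol(D') → M`. -/
noncomputable def cosetPolToSquare : MinionHom (polMinion (cosetTemplate ⊤)) squareMinion :=
  (squareToPol.symm squareToPol_bijective).comp
    ⟨fun _ _ F => ⟨F.1, F.2.subgroupTemplate_of_coset⟩, fun _ _ => rfl⟩

theorem cosetPolToSquare_app_eq_iff {D : Type} [Fintype D]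
    {F : (polMinion (cosetTemplate ⊤)).obj D} {s : SquareObj D} :
    cosetPolToSquare.app D F = s ↔ F.1 = fun x => eval x s.toTermPair :=
  (Equiv.symm_apply_eq _).trans Subtype.ext_iff

theorem cosetPolToSquare_injective (D : Type) [Fintype D] :
    Function.Injective (cosetPolToSquare.app D) := fun _ _ h =>
  Subtype.ext <| (cosetPolToSquare_app_eq_iff.1 h).trans (cosetPolToSquare_app_eq_iff.1 rfl).symm

theorem exists_cosetPolToSquare_app_eq_iff {D : Type} [Fintype D] (s : SquareObj D) :
    (∃ F, cosetPolToSquare.app D F = s) ↔ ∀ a, ∑ b, s.g (a, b) = 0 := by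
  simp only [cosetPolToSquare_app_eq_iff, ← s.isPolymorphism_cosetTemplate_top_iff]
  exact ⟨fun ⟨F, hF⟩ => hF ▸ F.2, fun h => ⟨⟨_, h⟩, rfl⟩⟩

/-! ### Centering -/

section Centering

variable {D E M : Type} [Fintype D] [Fintype E] [AddCommGroup M]

open Classical in
/-- The matrix `g` with its diagonal changed so that all row sums vanish. -/
noncomputable def centerRows (g : D × D → M) : D × D → M :=
  fun q => g q - if q.1 = q.2 then ∑ b, g (q.1, b) else 0

theorem centerRows_self (g : D × D → M) (a : D) :
    centerRows g (a, a) = g (a, a) - ∑ b, g (a, b) := by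
  simp [centerRows]

theorem centerRows_of_ne (g : D × D → M) {a b : D} (hab : a ≠ b) :
    centerRows g (a, b) = g (a, b) := by
  simp [centerRows, hab]

theorem sum_centerRows_row (g : D × D → M) (a : D) : ∑ b, centerRows g (a, b) = 0 := by
  classical
  simp [centerRows, Finset.sum_sub_distrib]

theorem sum_centerRows (g : D × D → M) : ∑ q, centerRows g q = 0 := by
  simp [Fintype.sum_prod_type, sum_centerRows_row]

theorem sum_push_prodMap_row (α : D → E) (g : D × D → M) (c : E) :
    ∑ d, push (Prod.map α α) g (c, d) = push α (fun a => ∑ b, g (a, b)) c := by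
  classical
  simp only [push_prodMap_apply]
  rw [Finset.sum_comm, push]
  exact Finset.sum_congr rfl fun a _ => Finset.sum_fiberwise _ _ _

theorem push_centerRows (α : D → E) (g : D × D → M) :
    push (Prod.map α α) (centerRows g) = centerRows (push (Prod.map α α) g) := by
  classical
  have hdiag (c d : E) :
      push (Prod.map α α) (fun q => if q.1 = q.2 then ∑ b, g (q.1, b) else 0) (c, d) =
        if c = d then push α (fun a => ∑ b, g (a, b)) c else 0 := by
    rw [push_prodMap_apply, push]
    simp only [Finset.sum_ite_eq, Finset.mem_filter, Finset.mem_univ, true_and]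
    split_ifs with hcd
    · exact Finset.sum_congr rfl fun a ha => if_pos <| hcd ▸ (Finset.mem_filter.1 ha).2
    · exact Finset.sum_eq_zero fun a ha => if_neg <| (Finset.mem_filter.1 ha).2 ▸ hcd
  ext ⟨c, d⟩
  change push _ (g - _) _ = _
  rw [push_sub, Pi.sub_apply, hdiag, ← sum_push_prodMap_row]
  simp [centerRows]

end Centering

namespace SquareObj

variable {D E : Type} [Fintype D] [Fintype E]

/-- The element of `M` with vanishing row sums determined by `f` and the off-diagonal part of
`g`. -/
noncomputable def centered (f : D → ZMod 2) (g : D × D → ZMod 2) (hf : ∑ a, f a = 1)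
    (hg : ∀ a b, a ≠ b → g (a, b) + g (b, a) = f a * f b) : SquareObj D where
  f := f
  g := centerRows g
  sum_f := hf
  sum_g := sum_centerRows g
  symm a b hab := by rw [centerRows_of_ne g hab, centerRows_of_ne g hab.symm, hg a b hab]

theorem centered_eq_map {f : D → ZMod 2} {g : D × D → ZMod 2} {hf hg} (α : D → E)
    {f' : E → ZMod 2} {g' : E × E → ZMod 2} {hf' hg'} (hff' : f' = push α f)
    (hgg' : g' = push (Prod.map α α) g) :
    centered f' g' hf' hg' = squareMinion.map α (centered f g hf hg) := by
  subst hff' hgg'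
  exact SquareObj.ext rfl (push_centerRows α g).symm

theorem isPolymorphism_eval_centered {f : D → ZMod 2} {g : D × D → ZMod 2} {hf hg} (m : ℕ∞) :
    IsPolymorphism (cosetTemplate m) fun x => eval x (centered f g hf hg).toTermPair :=
  ((centered f g hf hg).isPolymorphism_cosetTemplate_top_iff.2
    (sum_centerRows_row g)).cosetTemplate_of_top m

end SquareObj

/-- The endomorphism of `M` that changes the diagonal of `g` so as to make the row sums vanish. -/
noncomputable def centering : MinionHom squareMinion squareMinion where
  app _ _ s := SquareObj.centered s.f s.g s.sum_f s.symm
  naturality α _ := SquareObj.centered_eq_map α rfl rfl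

/-- The homomorphism from `M` to `Pol(D_m)`: evaluation of the centered pair as a word. -/
noncomputable def squareToPolCoset (m : ℕ∞) :
    MinionHom squareMinion (polMinion (cosetTemplate m)) where
  app _ _ s := ⟨_, SquareObj.isPolymorphism_eval_centered (hf := s.sum_f) (hg := s.symm) m⟩
  naturality α s := by
    have h := (congrArg (squareToPol.app _) (centering.naturality α s)).trans
      (squareToPol.naturality α (centering.app _ s))
    exact Subtype.ext (congrArg Subtype.val h :)

/-! ### Rounding -/

section Gram

variable {D E R W : Type} [Fintype D] [CommSemiring R] [AddCommMonoid W] [Module R W]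

/-- The Gram matrix of a family of vectors with respect to a bilinear form. -/
def gram (Q : LinearMap.BilinForm R W) (v : D → W) : D × D → R :=
  fun q => Q (v q.1) (v q.2)

theorem gram_push (Q : LinearMap.BilinForm R W) (α : D → E) (v : D → W) :
    gram Q (push α v) = push (Prod.map α α) (gram Q v) := by
  ext ⟨c, d⟩
  rw [push_prodMap_apply]
  simp only [gram, push, map_sum, LinearMap.sum_apply]
  exact Finset.sum_comm

end Gram

namespace SquareObj

variable {D E W : Type} [Fintype D] [Fintype E] [AddCommGroup W] [Module (ZMod 2) W]
  (w : W →ₗ[ZMod 2] ZMod 2) (Q : LinearMap.BilinForm (ZMod 2) W)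

section Round

variable {v : D → W} (hw : w (∑ a, v a) = 1)
  (hQ : ∀ a b, a ≠ b → Q (v a) (v b) + Q (v b) (v a) = w (v a) * w (v b))

/-- Rounding of a family of vectors. -/
noncomputable def round : SquareObj D :=
  centered (w ∘ v) (gram Q v) (by simpa using hw) hQ

theorem round_g_self (a : D) :
    (round w Q hw hQ).g (a, a) = Q (v a) (v a - ∑ b, v b) := by
  rw [map_sub, map_sum]
  exact centerRows_self _ a

theorem round_g_of_ne {a b : D} (hab : a ≠ b) :
    (round w Q hw hQ).g (a, b) = Q (v a) (v b) :=
  centerRows_of_ne _ hab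

theorem sum_round_g_row (a : D) : ∑ b, (round w Q hw hQ).g (a, b) = 0 :=
  sum_centerRows_row _ a

theorem round_eq_map (α : D → E) {v' : E → W} {hw' hQ'} (hv' : v' = push α v) :
    round w Q (v := v') hw' hQ' = squareMinion.map α (round w Q hw hQ) := by
  refine centered_eq_map α ?_ ?_
  · rw [hv']
    exact funext fun b => map_push w.toAddMonoidHom α v b
  · rw [hv', gram_push]

end Round

end SquareObj

section VectorMinion

variable {N : ℕ}

/-- The weight as a linear form. -/
def weightLin (p N : ℕ) : (Fin N → ZMod p) →ₗ[ZMod p] ZMod p where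
  toFun := weight
  map_add' _ _ := Finset.sum_add_distrib
  map_smul' c _ := (Finset.mul_sum _ _ c).symm

theorem IsRoundingForm.add_of_orthogonal {Q : LinearMap.BilinForm (ZMod 2) (Fin N → ZMod 2)}
    (hQ : IsRoundingForm Q) {v w : Fin N → ZMod 2} (hvw : v ⬝ᵥ w = 0) :
    Q v w + Q w v = weight v * weight w := by
  rw [hQ, hvw, add_zero]

namespace IsVectorSolution

variable {D : LCInstance} {i : Fin N → ZMod 2} {v : (x : D.Var) → D.dom x → Fin N → ZMod 2}
  {Q : LinearMap.BilinForm (ZMod 2) (Fin N → ZMod 2)}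

/-- The solution in `M` obtained by rounding a vector solution. -/
noncomputable def round (hv : IsVectorSolution D i v) (hQ : IsRoundingForm Q) (x : D.Var) :
    SquareObj (D.dom x) :=
  SquareObj.round (weightLin 2 N) Q (v := v x) ((congrArg weight (hv.sum_v x)).trans hv.weight_i)
    fun a b hab => hQ.add_of_orthogonal (hv.orth x a b hab)

theorem isSolutionIn_round (hv : IsVectorSolution D i v) (hQ : IsRoundingForm Q) :
    D.IsSolutionIn squareMinion (hv.round hQ) :=
  fun c => SquareObj.round_eq_map _ Q _ _ _ (hv.constr c)

theorem round_g_self (hv : IsVectorSolution D i v) (hQ : IsRoundingForm Q) (x : D.Var)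
    (a : D.dom x) : (hv.round hQ x).g (a, a) = Q (v x a) (v x a - i) :=
  (SquareObj.round_g_self _ _ _ _ a).trans (by rw [hv.sum_v x])

end IsVectorSolution

namespace VectorObj

theorem dotProduct_eq_zero {p : ℕ} {D : Type} [Fintype D] (t : VectorObj 2 p D) {a b : D}
    (hab : a ≠ b) : t.v a ⬝ᵥ t.v b = 0 := by
  simpa [weight, dotProduct] using t.orth a b hab Fin.elim0 fun j => j.elim0

variable {D : Type} [Fintype D] (t : VectorObj 2 2 D)
  {Q : LinearMap.BilinForm (ZMod 2) (Fin t.N → ZMod 2)} (hQ : IsRoundingForm Q)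

/-- The element of `M` obtained by rounding an element of `V_2-Z_2`. -/
noncomputable def round : SquareObj D :=
  SquareObj.round (weightLin 2 t.N) Q (v := t.v) ((congrArg weight t.sum_v).trans t.weight_i)
    fun _ _ hab => hQ.add_of_orthogonal (t.dotProduct_eq_zero hab)

theorem round_g_self (a : D) : (t.round hQ).g (a, a) = Q (t.v a) (t.v a - t.i) :=
  (SquareObj.round_g_self _ _ _ _ a).trans (by rw [t.sum_v])

theorem round_g_of_ne {a b : D} (hab : a ≠ b) : (t.round hQ).g (a, b) = Q (t.v a) (t.v b) :=
  SquareObj.round_g_of_ne _ _ _ _ hab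

theorem sum_round_g_row (a : D) : ∑ b, (t.round hQ).g (a, b) = 0 :=
  SquareObj.sum_round_g_row _ _ _ _ a

end VectorObj

/-- The rounding of `V_2-Z_2` given by a choice of forms. -/
noncomputable def roundingHom {Q : (N : ℕ) → LinearMap.BilinForm (ZMod 2) (Fin N → ZMod 2)}
    (hQ : ∀ N, IsRoundingForm (Q N)) : MinionHom (vectorMinion 2 2) squareMinion where
  app _ _ t := t.round (hQ t.N)
  naturality α _ := SquareObj.round_eq_map _ _ _ _ α rfl

end VectorMinion

/-- The bilinear form `(v, w) ↦ ∑_{i < j} v_i w_j`. -/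
def upperForm (R ι : Type*) [CommRing R] [Fintype ι] [LinearOrder ι] :
    LinearMap.BilinForm R (ι → R) :=
  Matrix.toBilin' (Matrix.of fun i j => if i < j then 1 else 0)

section UpperForm

variable {R ι : Type*} [CommRing R] [Fintype ι] [LinearOrder ι]

theorem upperForm_apply [LocallyFiniteOrderTop ι] (v w : ι → R) :
    upperForm R ι v w = ∑ i, ∑ j ∈ Finset.Ioi i, v i * w j := by
  simp [upperForm, Matrix.toBilin'_apply, ← Finset.sum_filter, Finset.filter_lt_eq_Ioi]

theorem upperForm_add_flip (v w : ι → R) :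
    upperForm R ι v w + upperForm R ι w v = (∑ i, v i) * ∑ i, w i - v ⬝ᵥ w := by
  have hlower : upperForm R ι w v = ∑ i, ∑ j, if j < i then v i * w j else 0 := by
    rw [Finset.sum_comm]
    simp [upperForm, Matrix.toBilin'_apply, mul_comm]
  have hdot : v ⬝ᵥ w = ∑ i, ∑ j, if i = j then v i * w j else 0 := by
    simp [dotProduct]
  rw [hlower, hdot, Finset.sum_mul_sum]
  simp only [upperForm, Matrix.toBilin'_apply, Matrix.of_apply, ← Finset.sum_add_distrib,
    ← Finset.sum_sub_distrib]
  refine Finset.sum_congr rfl fun i _ => Finset.sum_congr rfl fun j _ => ?_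
  obtain h | rfl | h := lt_trichotomy i j
  · simp [h, h.not_gt, h.ne]
  · simp
  · simp [h, h.not_gt, h.ne']

end UpperForm

theorem isRoundingForm_upperForm (N : ℕ) : IsRoundingForm (upperForm (ZMod 2) (Fin N)) :=
  fun v w => by rw [upperForm_add_flip, CharTwo.sub_eq_add]; rfl

/-! ### Symmetric matrices over the two-element field -/

theorem exists_sub_flip_eq_of_isAlt {R W : Type*} [CommRing R] [AddCommGroup W] [Module R W]
    [Module.Free R W] {β : LinearMap.BilinForm R W} (hβ : β.IsAlt) :
    ∃ Q : LinearMap.BilinForm R W, ∀ u v, Q u v - Q v u = β u v := by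
  classical
  let b := Module.Free.chooseBasis R W
  let _ : LinearOrder (Module.Free.ChooseBasisIndex R W) := linearOrderOfSTO WellOrderingRel
  let Q := b.constr R fun i => b.constr R fun j => if i < j then β (b i) (b j) else 0
  have hQ : Q - Q.flip = β := LinearMap.BilinForm.ext_basis b fun i j => by
    obtain h | rfl | h := lt_trichotomy i j
    · simp [Q, h, h.not_gt]
    · simp [Q, hβ.self_eq_zero]
    · simpa [Q, h, h.not_gt] using LinearMap.IsAlt.neg hβ (b j) (b i)
  exact ⟨Q, fun u v => LinearMap.congr_fun₂ hQ u v⟩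

section SelfPairing

variable {W : Type*} [AddCommGroup W] [Module (ZMod 2) W] {β : LinearMap.BilinForm (ZMod 2) W}

/-- In characteristic 2 the quadratic form `u ↦ β u u` of a symmetric form `β` is linear; it plays
the role of the weight. -/
def selfPairing (hβ : β.IsSymm) : W →ₗ[ZMod 2] ZMod 2 :=
  AddMonoidHom.toZModLinearMap 2 <| AddMonoidHom.mk' (fun u => β u u) fun u v => by
    have huv := CharTwo.add_self_eq_zero (β u v)
    simp only [map_add, LinearMap.add_apply, hβ.eq v u]
    linear_combination huv

theorem exists_add_flip_eq (hβ : β.IsSymm) : ∃ Q : LinearMap.BilinForm (ZMod 2) W,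
    ∀ u v, Q u v + Q v u = selfPairing hβ u * selfPairing hβ v + β u v := by
  let w := selfPairing hβ
  have halt : (LinearMap.BilinForm.linMulLin w w + β).IsAlt := fun u => by
    rw [LinearMap.add_apply, LinearMap.add_apply, LinearMap.BilinForm.linMulLin_apply, ← sq,
      ZMod.pow_card]
    exact CharTwo.add_self_eq_zero _
  obtain ⟨Q, hQ⟩ := exists_sub_flip_eq_of_isAlt halt
  exact ⟨Q, fun u v => by rw [← CharTwo.sub_eq_add, hQ]; rfl⟩

end SelfPairing

section GramSpace

variable {R ι : Type} [CommRing R] [Fintype ι] [DecidableEq ι]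

/-- The module generated by vectors with Gram matrix `B`, modulo the vectors orthogonal to all
others. -/
abbrev GramSpace (B : Matrix ι ι R) : Type :=
  (ι → R) ⧸ (Matrix.toBilin' B).ker

/-- The generators of `GramSpace B`. -/
def gramVector (B : Matrix ι ι R) (i : ι) : GramSpace B :=
  Submodule.Quotient.mk (Pi.single i 1)

theorem gramVector_comp_eq_push {B : Matrix ι ι R} {D E : Type} [Fintype D] {α : D → E}
    {r : D → ι} {s : E → ι} (h : ∀ b k, B (s b) k = push α (fun a => B (r a) k) b) :
    gramVector B ∘ s = push α (gramVector B ∘ r) := by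
  classical
  have hinj : Function.Injective ((Matrix.toBilin' B).ker.liftQ (Matrix.toBilin' B) le_rfl) :=
    LinearMap.ker_eq_bot.1 (Submodule.ker_liftQ_eq_bot _ _ _ le_rfl)
  have hrow (i k : ι) : (Matrix.toBilin' B).ker.liftQ (Matrix.toBilin' B) le_rfl
      (gramVector B i) (Pi.single k 1) = B i k := by simp [gramVector]
  refine funext fun b => hinj <| LinearMap.pi_ext' fun k => LinearMap.ext_ring ?_
  have hsum := h b k
  rw [push_apply] at hsum ⊢
  simp only [map_sum, LinearMap.sum_apply, LinearMap.comp_apply, LinearMap.coe_single,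
    Function.comp_apply, hrow]
  exact hsum

variable {B : Matrix ι ι R}

/-- The bilinear form on `GramSpace B` with Gram matrix `B`. -/
def gramForm (hB : B.IsSymm) : LinearMap.BilinForm R (GramSpace B) :=
  (Matrix.isSymm_toBilin'_iff_isSymm.2 hB).isRefl.liftQ₂ _ _ le_rfl

theorem gramForm_gramVector (hB : B.IsSymm) (i j : ι) :
    gramForm hB (gramVector B i) (gramVector B j) = B i j := by
  simp [gramForm, gramVector]

theorem isSymm_gramForm (hB : B.IsSymm) : (gramForm hB).IsSymm := by
  constructor
  rintro ⟨u⟩ ⟨v⟩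
  exact (Matrix.isSymm_toBilin'_iff_isSymm.2 hB).eq u v

end GramSpace

/-! ### The second level of the `Z_2` relaxation -/

namespace LCInstance

variable {D : LCInstance}

/-- A matrix indexed by the pairs of a variable and a value that could be the Gram matrix of a
vector solution. -/
structure IsGramSolution (D : LCInstance)
    (B : Matrix ((x : D.Var) × D.dom x) ((x : D.Var) × D.dom x) (ZMod 2)) : Prop where
  isSymm : B.IsSymm
  orth : ∀ x a b, a ≠ b → B ⟨x, a⟩ ⟨x, b⟩ = 0
  sum_diag : ∀ x, ∑ a, B ⟨x, a⟩ ⟨x, a⟩ = 1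
  constr : ∀ c b q, B ⟨D.tgt c, b⟩ q = push (D.fn c) (fun a => B ⟨D.src c, a⟩ q) b

theorem IsGramSolution.solvableIn_squareMinion
    {B : Matrix ((x : D.Var) × D.dom x) ((x : D.Var) × D.dom x) (ZMod 2)}
    (hB : D.IsGramSolution B) : D.SolvableIn squareMinion := by
  classical
  have hβ := isSymm_gramForm hB.isSymm
  obtain ⟨Q, hQ⟩ := exists_add_flip_eq hβ
  have hw (p) : selfPairing hβ (gramVector B p) = B p p := gramForm_gramVector hB.isSymm p p
  have hsum (x) : selfPairing hβ (∑ a, gramVector B ⟨x, a⟩) = 1 := by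
    simp only [map_sum, hw, hB.sum_diag]
  have horth (x) (a b : D.dom x) (hab : a ≠ b) :
      Q (gramVector B ⟨x, a⟩) (gramVector B ⟨x, b⟩) +
        Q (gramVector B ⟨x, b⟩) (gramVector B ⟨x, a⟩) =
      selfPairing hβ (gramVector B ⟨x, a⟩) * selfPairing hβ (gramVector B ⟨x, b⟩) := by
    rw [hQ, gramForm_gramVector, hB.orth x a b hab, add_zero]
  exact ⟨fun x => SquareObj.round (selfPairing hβ) Q (hsum x) (horth x), fun c =>
    SquareObj.round_eq_map _ Q _ _ _ (gramVector_comp_eq_push (hB.constr c))⟩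

section TupleValue

variable {k : ℕ} (s : ∀ x : (D.satPower k).Var, (zMinion 2).obj ((D.satPower k).dom x))

/-- The value of a solution of a saturated power in `Z_2` at a tuple of values of variables. -/
def tupleValue (P : Fin k → (x : D.Var) × D.dom x) : ZMod 2 :=
  (s fun i => (P i).1).1 fun i => (P i).2

variable {s} (hs : (D.satPower k).IsSolutionIn (zMinion 2) s)
include hs

theorem tupleValue_comp_of_surjective (P : Fin k → (x : D.Var) × D.dom x) {σ : Fin k → Fin k}
    (hσ : σ.Surjective) : tupleValue s (P ∘ σ) = tupleValue s P := by
  have hminor := congrArg Subtype.val (hs (.inr (fun i => (P i).1, σ)))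
  have hinj : Function.Injective fun (d : ∀ i, D.dom (P i).1) i => d (σ i) := fun d d' h => by
    funext i
    obtain ⟨j, rfl⟩ := hσ i
    exact congrFun h j
  exact (congrFun hminor fun i => (P (σ i)).2).trans
    (push_apply_of_injective hinj _ fun i => (P i).2)

theorem tupleValue_eq_zero {x : D.Var} {e : Fin k → D.dom x} {i j : Fin k} (h : e i ≠ e j) :
    tupleValue s (fun l => ⟨x, e l⟩) = 0 := by
  have hminor := congrArg Subtype.val (hs (.inr (fun _ => x, fun _ => i)))
  refine (congrFun hminor e).trans (push_apply_eq_zero fun d hd => ?_)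
  exact absurd ((congrFun hd i).symm.trans (congrFun hd j)) h

theorem sum_tupleValue_const [NeZero k] (x : D.Var) :
    ∑ a, tupleValue s (fun _ => ⟨x, a⟩) = 1 := by
  refine .trans ?_ (s fun _ => x).2
  refine Fintype.sum_of_injective (fun a _ => a) (fun a b h => congrFun h 0) _ _ ?_ fun _ => rfl
  intro e he
  obtain ⟨i, hi⟩ : ∃ i, e i ≠ e 0 := by
    by_contra! h
    exact he ⟨e 0, funext fun i => (h i).symm⟩
  exact tupleValue_eq_zero hs hi

end TupleValue

variable {s : ∀ x : (D.satPower 2).Var, (zMinion 2).obj ((D.satPower 2).dom x)}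

theorem tupleValue_pair {x : Fin 2 → D.Var} (d : ∀ i, D.dom (x i)) :
    tupleValue s ![⟨x 0, d 0⟩, ⟨x 1, d 1⟩] = (s x).1 d := by
  have hpair : ![⟨x 0, d 0⟩, ⟨x 1, d 1⟩] = fun i => (⟨x i, d i⟩ : (x : D.Var) × D.dom x) :=
    funext fun i => by fin_cases i <;> rfl
  rw [hpair, tupleValue]

theorem tupleValue_tgt (hs : (D.satPower 2).IsSolutionIn (zMinion 2) s) (c : D.Con)
    (b : D.dom (D.tgt c)) (q : (x : D.Var) × D.dom x) :
    tupleValue s ![⟨D.tgt c, b⟩, q] =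
      push (D.fn c) (fun a => tupleValue s ![⟨D.src c, a⟩, q]) b := by
  let k : Fin 2 → D.addId.Con := ![.inl c, .inr q.1]
  let tgtPair : ∀ i, D.dom (D.addId.tgt (k i)) := (piFinTwoEquiv _).symm (b, q.2)
  let srcPair (a : D.dom (D.src c)) : ∀ i, D.dom (D.addId.src (k i)) :=
    (piFinTwoEquiv _).symm (a, q.2)
  have htgt : tupleValue s ![⟨D.tgt c, b⟩, q] = _ := tupleValue_pair tgtPair
  have hsrc (a) : tupleValue s ![⟨D.src c, a⟩, q] = _ := tupleValue_pair (srcPair a)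
  have hminor := congrArg Subtype.val (hs (.inl k))
  rw [htgt, funext hsrc]
  refine (congrFun hminor tgtPair).trans
    (push_apply_eq_push_comp (α := (D.satPower 2).fn (.inl k)) (j := srcPair) ?_ ?_ _ ?_)
  · exact fun a a' h => congrFun h 0
  · intro a
    refine ⟨fun h => congrFun h 0, fun h => funext fun i => ?_⟩
    fin_cases i
    · exact h
    · rfl
  · intro d hd hrange
    refine absurd ⟨d 0, funext fun i => ?_⟩ hrange
    fin_cases i
    · rfl
    · exact (congrFun hd 1).symm

theorem isGramSolution_tupleValue (hs : (D.satPower 2).IsSolutionIn (zMinion 2) s) :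
    D.IsGramSolution fun p q => tupleValue s ![p, q] where
  isSymm := Matrix.IsSymm.ext fun p q => by
    rw [← tupleValue_comp_of_surjective hs ![p, q] (Equiv.swap 0 1).surjective]
    congr 1
    funext i
    fin_cases i <;> rfl
  orth x a b hab := (tupleValue_pair (x := fun _ => x) ![a, b]).trans
    (tupleValue_eq_zero hs (e := ![a, b]) (i := 0) (j := 1) hab)
  sum_diag x := .trans (Finset.sum_congr rfl fun a _ => tupleValue_pair fun _ => a)
    (sum_tupleValue_const hs x)
  constr := tupleValue_tgt hs

theorem SolvableIn.squareMinion (h : (D.satPower 2).SolvableIn (zMinion 2)) :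
    D.SolvableIn squareMinion := by
  obtain ⟨s, hs⟩ := h
  exact (isGramSolution_tupleValue hs).solvableIn_squareMinion

end LCInstance

theorem satPower_two_solvableIn_zMinion_iff {m : ℕ∞} (I : TemplateInstance (cosetTemplate m)) :
    (I.toCSP.lc.satPower 2).SolvableIn (zMinion 2) ↔ I.toCSP.Solvable := by
  refine ⟨fun h => (solves_polMinion _).of_hom (squareToPolCoset m) I h.squareMinion, fun h => ?_⟩
  obtain ⟨d, hd⟩ := h.exists_isAssignment_lc
  exact (hd.satPower 2).solvableIn (R := zMinion 2) ⟨1, by simp⟩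

/-! ### Acceptance of instances with a fixed variable -/

namespace CSPInstance

variable {I : CSPInstance}

open Classical in
theorem SinglAccepts.of_forall {Acc : CSPInstance → Prop} [∀ x, Nonempty (I.dom x)]
    (h : ∀ x a, Acc (I.restrict (Function.update (fun _ => Set.univ) x {a}))) :
    SinglAccepts Acc I := by
  refine ⟨fun _ => Set.univ, .refl, fun _ => Set.univ_nonempty, ?_⟩
  rintro ⟨T, x, a, -, hrej, -⟩
  exact hrej (h x a)

theorem mem_update_univ_singleton [DecidableEq I.Var] {x₀ x : I.Var} {d : ∀ x, I.dom x} :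
    d x ∈ Function.update (fun _ => Set.univ) x₀ {d x₀} x := by
  obtain rfl | hx := eq_or_ne x x₀ <;> simp [*]

theorem solvableIn_restrict_update [DecidableEq I.Var] {R : Minion} {K : Type} [Fintype K]
    [Nonempty K] (r : R.obj K) {x₀ : I.Var} {a : I.dom x₀} (V : K → (x : I.Var) → I.dom x)
    (T : (c : I.Con) → K → (i : Fin (I.ar c)) → I.dom (I.scope c i))
    (hV : ∀ k, V k x₀ = a) (hT : ∀ c k, T c k ∈ I.rel c)
    (hTV : ∀ c k i, I.scope c i = x₀ → T c k i = V k (I.scope c i))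
    (hr : ∀ c i, R.map (fun k => V k (I.scope c i)) r = R.map (fun k => T c k i) r) :
    (I.restrict (Function.update (fun _ => Set.univ) x₀ {a})).lc.SolvableIn R := by
  let S : (x : I.Var) → Set (I.dom x) := Function.update (fun _ => Set.univ) x₀ {a}
  have hVS (k x) : V k x ∈ S x := by
    obtain rfl := hV k
    exact mem_update_univ_singleton
  have hTS (c k i) : T c k i ∈ S (I.scope c i) := by
    by_cases hi : I.scope c i = x₀
    · rw [hTV c k i hi]
      exact hVS k _
    · simp [S, hi]
  let A : (y : (I.restrict S).lc.Var) → K → (I.restrict S).lc.dom y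
    | .inl x => fun k => ⟨V k x, hVS k x⟩
    | .inr c => fun k => ⟨fun i => ⟨T c k i, hTS c k i⟩, hT c k⟩
  refine LCInstance.solvableIn_of_map_eq r A fun ⟨c, i⟩ => ?_
  exact R.map_eq_map_of_comp_left (D := (I.restrict S).lc.dom ((I.restrict S).lc.tgt ⟨c, i⟩))
    (E := I.lc.dom (I.lc.tgt ⟨c, i⟩)) Subtype.val_injective (hr c i)

end CSPInstance

/-! ### Relations defined by quadratic forms in the coordinates -/

section CoordSubgroup

variable {n : ℕ}

theorem coordP_comp_mul (x y : Fin n → D4) : coordP ∘ (x * y) = coordP ∘ x + coordP ∘ y := by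
  ext i
  simp

theorem coordQ_comp_mul (x y : Fin n → D4) : coordQ ∘ (x * y) = coordQ ∘ x + coordQ ∘ y := by
  ext i
  simp

theorem sum_coordZ_mul (x y : Fin n → D4) : ∑ i, coordZ ((x * y) i) =
    ∑ i, coordZ (x i) + ∑ i, coordZ (y i) + (coordP ∘ x) ⬝ᵥ (coordQ ∘ y) := by
  simp [dotProduct, Finset.sum_add_distrib]

theorem coordP_comp_inv (x : Fin n → D4) : coordP ∘ x⁻¹ = coordP ∘ x := by
  ext i
  simp

theorem coordQ_comp_inv (x : Fin n → D4) : coordQ ∘ x⁻¹ = coordQ ∘ x := by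
  ext i
  simp

theorem sum_coordZ_inv (x : Fin n → D4) : ∑ i, coordZ (x⁻¹ i) =
    ∑ i, coordZ (x i) + (coordP ∘ x) ⬝ᵥ (coordQ ∘ x) := by
  simp [dotProduct, Finset.sum_add_distrib]

variable (L : AddSubmonoid ((Fin n → ZMod 2) × (Fin n → ZMod 2)))
  (φ : (Fin n → ZMod 2) × (Fin n → ZMod 2) → ZMod 2)
  (hφ : ∀ u ∈ L, ∀ v ∈ L, φ (u + v) = φ u + φ v + u.1 ⬝ᵥ v.2)

/-- The tuples over `D_4` whose noncentral coordinates lie in `L`, and whose central coordinates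
sum up to `φ` of the noncentral ones. That this is a subgroup means that the polarization of `φ`
agrees on `L` with the cocycle `u.1 ⬝ᵥ v.2` describing the multiplication. -/
def coordSubgroup : Subgroup (Fin n → D4) where
  carrier := {x | (coordP ∘ x, coordQ ∘ x) ∈ L ∧
    ∑ i, coordZ (x i) = φ (coordP ∘ x, coordQ ∘ x)}
  one_mem' := by
    have hφ0 : φ 0 = 0 := by simpa using hφ 0 L.zero_mem 0 L.zero_mem
    exact ⟨L.zero_mem, Finset.sum_const_zero.trans hφ0.symm⟩
  mul_mem' := by
    rintro x y ⟨hx, hxz⟩ ⟨hy, hyz⟩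
    rw [Set.mem_ofPred, coordP_comp_mul, coordQ_comp_mul, sum_coordZ_mul, ← Prod.mk_add_mk,
      hφ _ hx _ hy, hxz, hyz]
    exact ⟨L.add_mem hx hy, rfl⟩
  inv_mem' := by
    rintro x ⟨hx, hxz⟩
    have hdot : (coordP ∘ x) ⬝ᵥ (coordQ ∘ x) = 0 := by
      have hφ0 : φ 0 = 0 := by simpa using hφ 0 L.zero_mem 0 L.zero_mem
      have hadd : (coordP ∘ x, coordQ ∘ x) + (coordP ∘ x, coordQ ∘ x) = 0 := by
        ext i <;> exact CharTwo.add_self_eq_zero _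
      have hxx := hφ _ hx _ hx
      rwa [hadd, hφ0, CharTwo.add_self_eq_zero, zero_add, eq_comm] at hxx
    rw [Set.mem_ofPred, coordP_comp_inv, coordQ_comp_inv, sum_coordZ_inv, hdot, add_zero]
    exact ⟨hx, hxz⟩

include hφ in
theorem isCoset_coords [NeZero n] (c : ZMod 2) :
    IsCoset {x : Fin n → D4 | (coordP ∘ x, coordQ ∘ x) ∈ L ∧
      ∑ i, coordZ (x i) = φ (coordP ∘ x, coordQ ∘ x) + c} := by
  let g : Fin n → D4 := Pi.mulSingle 0 (ofCoords 0 0 c)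
  have hgg : g * g = 1 := by
    have hsq : ∀ c, ofCoords 0 0 c * ofCoords 0 0 c = 1 := by decide
    rw [← Pi.mulSingle_mul, hsq, Pi.mulSingle_one]
  have hgP : coordP ∘ g = 0 := by
    ext i
    obtain rfl | hi := eq_or_ne i 0 <;> simp [g, *]
  have hgQ : coordQ ∘ g = 0 := by
    ext i
    obtain rfl | hi := eq_or_ne i 0 <;> simp [g, *]
  have hgZ : ∑ i, coordZ (g i) = c := by
    rw [Finset.sum_eq_single_of_mem 0 (Finset.mem_univ _)] <;> simp +contextual [g]
  have hmem (x) : g * x ∈ coordSubgroup L φ hφ ↔ (coordP ∘ x, coordQ ∘ x) ∈ L ∧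
      ∑ i, coordZ (x i) = φ (coordP ∘ x, coordQ ∘ x) + c := by
    change (coordP ∘ (g * x), coordQ ∘ (g * x)) ∈ L ∧
      ∑ i, coordZ ((g * x) i) = φ (coordP ∘ (g * x), coordQ ∘ (g * x)) ↔ _
    rw [coordP_comp_mul, coordQ_comp_mul, sum_coordZ_mul, hgP, hgQ, hgZ, zero_add, zero_add,
      zero_dotProduct, add_zero, ← eq_sub_iff_add_eq', CharTwo.sub_eq_add]
  refine ⟨coordSubgroup L φ hφ, g, Set.ext fun x => ⟨fun hx => ⟨g * x, (hmem x).2 hx, ?_⟩, ?_⟩⟩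
  · rw [← mul_assoc, hgg, one_mul]
  · rintro ⟨h, hh, rfl⟩
    refine (hmem _).1 ?_
    rwa [← mul_assoc, hgg, one_mul]

end CoordSubgroup

/-! ### An unsolvable instance accepted by Singl(BLP+AIP) -/

/-- The first constraint inside a copy: equal second coordinates, and sum `0` in the first and in
the central coordinate. -/
def rowRel : Set (Fin 4 → D4) :=
  {x | (∀ i, coordQ (x i) = coordQ (x 0)) ∧ ∑ i, coordP (x i) = 0 ∧ ∑ i, coordZ (x i) = 0}

/-- The second constraint inside a copy: the second coordinates are `a, a, b, b`, the first
coordinates of the two pairs sum up to `b` and `a`, and the central ones sum up to `a * b + a`. -/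
def twistRel : Set (Fin 4 → D4) :=
  {x | coordQ (x 1) = coordQ (x 0) ∧ coordQ (x 3) = coordQ (x 2) ∧
    coordP (x 0) + coordP (x 1) = coordQ (x 2) ∧ coordP (x 2) + coordP (x 3) = coordQ (x 0) ∧
    ∑ i, coordZ (x i) = coordQ (x 0) * coordQ (x 2) + coordQ (x 0)}

/-- The constraint linking two copies: the tuples `(y, y', w, w')` with `y, y'` and `w, w'`
congruent modulo the center, and with sum `1` in the central coordinate. -/
def linkRel : Set (Fin 4 → D4) :=
  {x | coordP (x 1) = coordP (x 0) ∧ coordQ (x 1) = coordQ (x 0) ∧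
    coordP (x 3) = coordP (x 2) ∧ coordQ (x 3) = coordQ (x 2) ∧ ∑ i, coordZ (x i) = 1}

instance : DecidablePred (· ∈ rowRel) := fun _ => inferInstanceAs (Decidable (_ ∧ _))

instance : DecidablePred (· ∈ twistRel) := fun _ => inferInstanceAs (Decidable (_ ∧ _))

instance : DecidablePred (· ∈ linkRel) := fun _ => inferInstanceAs (Decidable (_ ∧ _))

theorem isCoset_rowRel : IsCoset rowRel := by
  let L : AddSubmonoid ((Fin 4 → ZMod 2) × (Fin 4 → ZMod 2)) :=
    { carrier := {u | (∀ i, u.2 i = u.2 0) ∧ ∑ i, u.1 i = 0}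
      zero_mem' := by simp
      add_mem' := by
        rintro u v ⟨huq, hup⟩ ⟨hvq, hvp⟩
        exact ⟨fun i => congrArg₂ (· + ·) (huq i) (hvq i), by
          simp [Finset.sum_add_distrib, hup, hvp]⟩ }
  have hL (u) (hu : u ∈ L) (v) (hv : v ∈ L) : u.1 ⬝ᵥ v.2 = 0 := by
    simp only [dotProduct, hv.1, ← Finset.sum_mul, hu.2, zero_mul]
  convert isCoset_coords L (fun _ => 0) (fun u hu v hv => by simp [hL u hu v hv]) 0 using 3 with x
  simp [L, rowRel, and_assoc]

theorem isCoset_twistRel : IsCoset twistRel := by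
  let L : AddSubmonoid ((Fin 4 → ZMod 2) × (Fin 4 → ZMod 2)) :=
    { carrier := {u | u.2 1 = u.2 0 ∧ u.2 3 = u.2 2 ∧ u.1 0 + u.1 1 = u.2 2 ∧
        u.1 2 + u.1 3 = u.2 0}
      zero_mem' := by simp
      add_mem' := by
        rintro u v ⟨hu1, hu3, hu, hu'⟩ ⟨hv1, hv3, hv, hv'⟩
        simp only [Set.mem_ofPred, Prod.fst_add, Prod.snd_add, Pi.add_apply]
        grind }
  have hφ (u) (hu : u ∈ L) (v) (hv : v ∈ L) : (u + v).2 0 * (u + v).2 2 + (u + v).2 0 =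
      u.2 0 * u.2 2 + u.2 0 + (v.2 0 * v.2 2 + v.2 0) + u.1 ⬝ᵥ v.2 := by
    obtain ⟨-, -, hu01, hu23⟩ := hu
    obtain ⟨hv1, hv3, -, -⟩ := hv
    simp only [dotProduct, Fin.sum_univ_four, Prod.snd_add, Pi.add_apply, hv1, hv3]
    linear_combination -v.2 0 * hu01 - v.2 2 * hu23
  convert isCoset_coords L (fun u => u.2 0 * u.2 2 + u.2 0) hφ 0 using 3 with x
  simp [L, twistRel, and_assoc]

theorem isCoset_linkRel : IsCoset linkRel := by
  let L : AddSubmonoid ((Fin 4 → ZMod 2) × (Fin 4 → ZMod 2)) :=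
    { carrier := {u | u.1 1 = u.1 0 ∧ u.2 1 = u.2 0 ∧ u.1 3 = u.1 2 ∧ u.2 3 = u.2 2}
      zero_mem' := by simp
      add_mem' := by
        rintro u v ⟨hu1, hu1', hu3, hu3'⟩ ⟨hv1, hv1', hv3, hv3'⟩
        simp [*] }
  have hL (u) (hu : u ∈ L) (v) (hv : v ∈ L) : u.1 ⬝ᵥ v.2 = 0 := by
    obtain ⟨hu1, -, hu3, -⟩ := hu
    obtain ⟨-, hv1, -, hv3⟩ := hv
    simp only [dotProduct, Fin.sum_univ_four, hu1, hu3, hv1, hv3, add_assoc,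
      CharTwo.add_self_eq_zero]
  convert isCoset_coords L (fun _ => 0) (fun u hu v hv => by simp [hL u hu v hv]) 1 using 3 with x
  simp [L, linkRel, and_assoc]

/-- The constraints of `foolInstance`: two for each of the copies, and one linking the copies. -/
inductive FoolCon
  | row (e : Bool)
  | twist (e : Bool)
  | link
  deriving DecidableEq, Fintype

namespace FoolCon

/-- The relation of a constraint of `foolInstance`. -/
def rel : FoolCon → Set (Fin 4 → D4)
  | row _ => rowRel
  | twist _ => twistRel
  | link => linkRel

/-- The scope of a constraint of `foolInstance`; the variable `(e, i)` is the `i`-th one of the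
copy `e`. -/
def scope : FoolCon → Fin 4 → Bool × Fin 5
  | row e => fun i => (e, ![0, 1, 2, 3] i)
  | twist e => fun i => (e, ![4, 1, 2, 3] i)
  | link => ![(false, 0), (false, 4), (true, 0), (true, 4)]

theorem isCoset_rel : ∀ c : FoolCon, IsCoset c.rel
  | row _ => isCoset_rowRel
  | twist _ => isCoset_twistRel
  | link => isCoset_linkRel

end FoolCon

/-- Two copies of a system which forces `coordZ` to agree at the variables `0` and `4`, linked by a
constraint asking for disagreement in exactly one of the copies. -/
def foolInstance {m : ℕ∞} (hm : 4 ≤ m) : TemplateInstance (cosetTemplate m) where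
  Var := Bool × Fin 5
  Con := FoolCon
  sym c := ⟨⟨4, hm⟩, c.rel, c.isCoset_rel⟩
  scope := FoolCon.scope

theorem coordZ_eq_of_mem_rowRel_of_mem_twistRel {x : Fin 5 → D4}
    (hrow : (fun i => x (![0, 1, 2, 3] i)) ∈ rowRel)
    (htwist : (fun i => x (![4, 1, 2, 3] i)) ∈ twistRel) : coordZ (x 0) = coordZ (x 4) := by
  obtain ⟨hq, -, hz⟩ := hrow
  obtain ⟨hq14, -, -, -, hz'⟩ := htwist
  have hq1 := hq 1
  have hq2 := hq 2
  have hidem : ∀ c : ZMod 2, c * c + c = 0 := by decide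
  simp only [Fin.sum_univ_four, Matrix.cons_val] at *
  rw [← hq14, hq1, hq2, hidem] at hz'
  linear_combination hz - hz'

theorem not_solvable_foolInstance {m : ℕ∞} (hm : 4 ≤ m) : ¬ (foolInstance hm).toCSP.Solvable := by
  rintro ⟨d, hd⟩
  have hz (e : Bool) : coordZ (d (e, 0)) = coordZ (d (e, 4)) :=
    coordZ_eq_of_mem_rowRel_of_mem_twistRel (x := fun i => d (e, i)) (hd (.row e)) (hd (.twist e))
  obtain ⟨-, -, -, -, hlink⟩ : (fun i => d (FoolCon.link.scope i)) ∈ linkRel := hd .link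
  simp only [Fin.sum_univ_four, FoolCon.scope, Matrix.cons_val, hz, CharTwo.add_self_eq_zero,
    add_assoc] at hlink
  exact zero_ne_one hlink

/-- A solution of the constraints inside a copy with value `a` at the variable `j`. -/
def copySolution (j : Fin 5) (a : D4) : Fin 5 → D4 :=
  let q := coordQ a
  let z := coordZ a
  let b : ZMod 2 := ![coordP a, coordP a + q, 0, 0, coordP a] j
  let b' : ZMod 2 := ![0, 0, coordP a, coordP a + q, 0] j
  ![ofCoords b q z, ofCoords (b + q) q z, ofCoords b' q z, ofCoords (b' + q) q z, ofCoords b q z]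

theorem copySolution_self (j : Fin 5) (a : D4) : copySolution j a j = a := by
  decide +revert

theorem copySolution_mem_rowRel (j : Fin 5) (a : D4) :
    (fun i => copySolution j a (![0, 1, 2, 3] i)) ∈ rowRel := by
  decide +revert

theorem copySolution_mem_twistRel (j : Fin 5) (a : D4) :
    (fun i => copySolution j a (![4, 1, 2, 3] i)) ∈ twistRel := by
  decide +revert

/-- The values of the variables of a copy in the relaxed solution, in which the variables `0` and
`4` disagree in the central coordinate. The index `k.1` runs through the nonzero pairs of
noncentral coordinates. -/
def relaxedVar (k : Fin 3 × ZMod 2) : Fin 5 → D4 :=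
  let p : ZMod 2 := ![1, 0, 1] k.1
  let q : ZMod 2 := ![0, 1, 1] k.1
  ![ofCoords p q 0, ofCoords 0 q k.2, ofCoords p q 0, ofCoords 0 q k.2, ofCoords p q 1]

/-- The tuples satisfying the second constraint of a copy in the relaxed solution. They are not of
the form `relaxedVar k ∘ ![4, 1, 2, 3]`, but agree with these in distribution, coordinate by
coordinate. -/
def relaxedTwist (k : Fin 3 × ZMod 2) : Fin 4 → D4 :=
  let p : ZMod 2 := ![1, 0, 1] k.1
  let q : ZMod 2 := ![0, 1, 1] k.1
  ![relaxedVar k 4, relaxedVar k 1, ofCoords q p 0, ofCoords 0 p (k.2 + p)]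

theorem relaxedVar_mem_rowRel (k : Fin 3 × ZMod 2) :
    (fun i => relaxedVar k (![0, 1, 2, 3] i)) ∈ rowRel := by
  decide +revert

theorem relaxedTwist_mem_twistRel (k : Fin 3 × ZMod 2) : relaxedTwist k ∈ twistRel := by
  decide +revert

/-- The joint distributions of the relaxed solution. -/
noncomputable def relaxedDistr : blpAipMinion.obj (Fin 3 × ZMod 2) where
  blp _ := 1 / 6
  aip k := if k.2 = 0 then ![1, 1, -1] k.1 else 0
  nonneg _ := by norm_num
  sum_blp := by simp
  sum_aip := by decide
  support _ h := by norm_num at h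

theorem map_relaxedVar_eq_map_relaxedTwist (i : Fin 4) :
    blpAipMinion.map (fun k => relaxedVar k (![4, 1, 2, 3] i)) relaxedDistr =
      blpAipMinion.map (fun k => relaxedTwist k i) relaxedDistr := by
  apply BLPAIPObj.ext
  · have hcard : ∀ i b, (Finset.univ.filter fun k => relaxedVar k (![4, 1, 2, 3] i) = b).card =
        (Finset.univ.filter fun k => relaxedTwist k i = b).card := by
      decide
    ext b
    change push (fun k => relaxedVar k (![4, 1, 2, 3] i)) (fun _ => (1 / 6 : ℝ)) b =
      push (fun k => relaxedTwist k i) (fun _ => (1 / 6 : ℝ)) b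
    rw [push_const, push_const, hcard]
  · ext b
    let aip (k : Fin 3 × ZMod 2) : ℤ := if k.2 = 0 then ![1, 1, -1] k.1 else 0
    change push (fun k => relaxedVar k (![4, 1, 2, 3] i)) aip b =
      push (fun k => relaxedTwist k i) aip b
    rw [push_apply_eq_sum_ite, push_apply_eq_sum_ite]
    revert i b
    decide

/-- The values of the variables in the relaxed solution with value `a` at the variable `(e, j)`:
constant in the copy `e`, and nonconstant in the other one. -/
def relaxedAssignment (e : Bool) (j : Fin 5) (a : D4) (k : Fin 3 × ZMod 2) (x : Bool × Fin 5) :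
    D4 :=
  if x.1 = e then copySolution j a x.2 else relaxedVar k x.2

/-- The tuples of the constraints in the relaxed solution with value `a` at the variable
`(e, j)`. -/
def relaxedTuple (e : Bool) (j : Fin 5) (a : D4) (c : FoolCon) (k : Fin 3 × ZMod 2) : Fin 4 → D4 :=
  if c = .twist !e then relaxedTwist k else fun i => relaxedAssignment e j a k (c.scope i)

theorem relaxedAssignment_link_mem (e : Bool) (j : Fin 5) (a : D4) (k : Fin 3 × ZMod 2) :
    (fun i => relaxedAssignment e j a k (FoolCon.link.scope i)) ∈ linkRel := by
  decide +revert

theorem relaxedTuple_mem (e : Bool) (j : Fin 5) (a : D4) (c : FoolCon) (k : Fin 3 × ZMod 2) :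
    relaxedTuple e j a c k ∈ c.rel := by
  unfold relaxedTuple
  split_ifs with hc
  · subst hc
    exact relaxedTwist_mem_twistRel k
  rcases c with e' | e' | -
  · obtain he | he := eq_or_ne e' e
    · simpa [FoolCon.rel, FoolCon.scope, relaxedAssignment, he] using copySolution_mem_rowRel j a
    · simpa [FoolCon.rel, FoolCon.scope, relaxedAssignment, he] using relaxedVar_mem_rowRel k
  · obtain rfl : e' = e := by simpa using hc
    simpa [FoolCon.rel, FoolCon.scope, relaxedAssignment] using copySolution_mem_twistRel j a
  · exact relaxedAssignment_link_mem e j a k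

theorem map_relaxedAssignment_eq_map_relaxedTuple (e : Bool) (j : Fin 5) (a : D4) (c : FoolCon)
    (i : Fin 4) : blpAipMinion.map (fun k => relaxedAssignment e j a k (c.scope i)) relaxedDistr =
      blpAipMinion.map (fun k => relaxedTuple e j a c k i) relaxedDistr := by
  unfold relaxedTuple
  split_ifs with hc
  · subst hc
    simpa [FoolCon.scope, relaxedAssignment] using map_relaxedVar_eq_map_relaxedTwist i
  · rfl

theorem singlAccepts_foolInstance {m : ℕ∞} (hm : 4 ≤ m) :
    CSPInstance.SinglAccepts BLPAIPAccepts (foolInstance hm).toCSP := by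
  classical
  have (x : (foolInstance hm).toCSP.Var) : Nonempty ((foolInstance hm).toCSP.dom x) := ⟨(1 : D4)⟩
  refine CSPInstance.SinglAccepts.of_forall fun ⟨e, j⟩ a => ?_
  refine CSPInstance.solvableIn_restrict_update (I := (foolInstance hm).toCSP) relaxedDistr
    (relaxedAssignment e j a) (relaxedTuple e j a) (fun k => ?_) (relaxedTuple_mem e j a) ?_
    (map_relaxedAssignment_eq_map_relaxedTuple e j a)
  · exact (if_pos rfl).trans (copySolution_self j a)
  · rintro c k i (hi : c.scope i = (e, j))
    refine congrFun (if_neg ?_) i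
    rintro rfl
    simp [FoolCon.scope] at hi

end SolvingSquare

open SolvingSquare in
theorem mainTheorem4 :
    -- rounding forms exist; the strictly upper triangular form is one
    (∀ N : ℕ, ∃ Q : LinearMap.BilinForm (ZMod 2) (Fin N → ZMod 2),
      (∀ v w, Q v w = ∑ i, ∑ j ∈ Finset.Ioi i, v i * w j) ∧ IsRoundingForm Q) ∧
    -- every vector solution is rounded to a solution in `M` by any such form
    (∀ (D : LCInstance) (N : ℕ) (Q : LinearMap.BilinForm (ZMod 2) (Fin N → ZMod 2))
      (i : Fin N → ZMod 2) (v : (x : D.Var) → D.dom x → Fin N → ZMod 2),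
      IsRoundingForm Q → IsVectorSolution D i v →
      ∃ s : (x : D.Var) → SquareObj (D.dom x),
        D.IsSolutionIn squareMinion s ∧
        (∀ x a, (s x).f a = weight (v x a)) ∧
        (∀ x a, (s x).g (a, a) = Q (v x a) (v x a - i)) ∧
        (∀ x a b, a ≠ b → (s x).g (a, b) = Q (v x a) (v x b)) ∧
        (∀ x a, ∑ b, (s x).g (a, b) = 0)) ∧
    -- the same rule is a minion homomorphism from `V_2-Z_2` to `M`
    (∀ Q : (N : ℕ) → LinearMap.BilinForm (ZMod 2) (Fin N → ZMod 2),
      (∀ N, IsRoundingForm (Q N)) →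
      ∃ ξ : MinionHom (vectorMinion 2 2) squareMinion,
        ∀ (D : Type) [Fintype D] (t : VectorObj 2 2 D) (s : SquareObj D), s = ξ.app D t →
          (∀ a, s.f a = weight (t.v a)) ∧
          (∀ a, s.g (a, a) = Q t.N (t.v a) (t.v a - t.i)) ∧
          (∀ a b, a ≠ b → s.g (a, b) = Q t.N (t.v a) (t.v b)) ∧
          (∀ a, ∑ b, s.g (a, b) = 0)) ∧
    -- `M` is the polymorphism minion of `D_4` with all subgroups and constants
    (∃ η : MinionHom (polMinion subgroupTemplate) squareMinion,
      ∀ (D : Type) [Fintype D], Function.Bijective (η.app D)) ∧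
    -- the polymorphism minion of `D_4` with all cosets is the subminion of `M` given by vanishing
    -- row sums, and `M` maps homomorphically to it
    (∃ η : MinionHom (polMinion (cosetTemplate ⊤)) squareMinion,
      ∀ (D : Type) [Fintype D], Function.Injective (η.app D) ∧
        ∀ s : SquareObj D, (∃ F, η.app D F = s) ↔ ∀ a, ∑ b, s.g (a, b) = 0) ∧
    (∀ m : ℕ∞, Nonempty (MinionHom squareMinion (polMinion (cosetTemplate m)))) ∧
    -- hence `V_2-Z_2` maps to it, every solution in `V_2-Z_2` gives one in it, and `V_2-Z_2`
    -- solves the coset CSP of `D_4`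
    (∀ m : ℕ∞, Nonempty (MinionHom (vectorMinion 2 2) (polMinion (cosetTemplate m))) ∧
      (∀ D : LCInstance, D.SolvableIn (vectorMinion 2 2) →
        D.SolvableIn (polMinion (cosetTemplate m))) ∧
      Solves (vectorMinion 2 2) (cosetTemplate m)) ∧
    -- the second level of the `Z_2` relaxation decides the coset CSP of `D_4`
    (∀ (m : ℕ∞) (I : TemplateInstance (cosetTemplate m)),
      (I.toCSP.lc.satPower 2).SolvableIn (zMinion 2) ↔ I.toCSP.Solvable) ∧
    -- the coset CSP of `D_4`, already with relations of arity at most 4, fools Singl(BLP+AIP)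
    (∀ m : ℕ∞, 4 ≤ m → ∃ I : TemplateInstance (cosetTemplate m),
      CSPInstance.SinglAccepts BLPAIPAccepts I.toCSP ∧ ¬ I.toCSP.Solvable) := by
  refine ⟨fun N => ⟨upperForm _ _, upperForm_apply, isRoundingForm_upperForm N⟩,
    fun D N Q i v hQ hv => ⟨hv.round hQ, hv.isSolutionIn_round hQ, fun _ _ => rfl,
      hv.round_g_self hQ, fun _ _ _ => SquareObj.round_g_of_ne _ _ _ _,
      fun _ => SquareObj.sum_round_g_row _ _ _ _⟩,
    fun Q hQ => ⟨roundingHom hQ, ?_⟩,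
    ⟨squareToPol.symm squareToPol_bijective, squareToPol.symm_bijective squareToPol_bijective⟩,
    ⟨cosetPolToSquare, fun D _ =>
      ⟨cosetPolToSquare_injective D, exists_cosetPolToSquare_app_eq_iff⟩⟩,
    fun m => ⟨squareToPolCoset m⟩, fun m => ?_,
    fun _ => satPower_two_solvableIn_zMinion_iff,
    fun _ hm => ⟨foolInstance hm, singlAccepts_foolInstance hm, not_solvable_foolInstance hm⟩⟩
  · rintro D _ t _ rfl
    exact ⟨fun _ => rfl, t.round_g_self (hQ t.N), fun _ _ => t.round_g_of_ne (hQ t.N),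
      t.sum_round_g_row (hQ t.N)⟩
  · let ξ := (squareToPolCoset m).comp (roundingHom isRoundingForm_upperForm)
    exact ⟨⟨ξ⟩, fun D hD => hD.map ξ, (solves_polMinion _).of_hom ξ⟩
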